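/- Let $\mathcal X$ be a finite set and let $W_0\neq W_1$ be two ergodic (irreducible and aperiodic) transition matrices on $\mathcal X$ with the same support, where $W_i(x|\bar x)$ is the probability of moving from $\bar x$ to $x$. Let $P_0,P_1$ be probability distributions on $\mathcal X$ that are not mutually singular (i.e. $P_0(x)>0$ and $P_1(x)>0$ for some common $x$), and let $$W_i^{\times n}\times P_i(x_{n+1},\dots,x_1)=P_i(x_1)\prod_{j=1}^n W_i(x_{j+1}|x_j)$$ be the law of the Markov chain on $\mathcal X^{n+1}$. Let $\phi(\theta)$ be the logarithm of the Perron–Frobenius eigenvalue of the matrix with entries $W_0(x|\bar x)e^{\theta g(x,\bar x)}$, $g(x,\bar x)=\log\frac{W_1(x|\bar x)}{W_0(x|\bar x)}$ (entries outside the support being $0$), and let $D(W_0\|W_1)$ be the derivative at $u=1$ of the logarithm of the Perron–Frobenius eigenvalue of $W_0(x|\bar x)^{u}W_1(x|\bar x)^{1-u}$. For distributions $P,Q$ on a finite set put $$\beta_\epsilon(P\|Q)=\min_T\{\mathsf E_Q[1-T] : \mathsf E_P[T]\le\epsilon\},$$ where the minimum is taken either over all randomized tests $T$ with values in $[0,1]$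 or only over all deterministic tests $T=1_S$; the statement holds for both readings. Then $D(W_0\|W_1)$ is well defined, $\phi$ is twice continuously differentiable at $0$ with $\phi''(0)>0$, and for every $t\in(0,\tfrac12)$ the following hold. (i) For every $\delta\ge 0$, $$\lim_{n\to\infty}-\frac{1}{n^{1-2t}}\log\beta_{e^{-nD(W_0\|W_1)+n^{1-t}\delta}}\bigl(W_1^{\times n}\times P_1\,\big\|\,W_0^{\times n}\times P_0\bigr)=\frac{\delta^2}{2\phi''(0)}.$$ (ii) For every $r>0$, as $n\to\infty$, $$-\log\beta_{e^{-n^{1-2t}r}}\bigl(W_0^{\times n}\times P_0\,\big\|\,W_1^{\times n}\times P_1\bigr)=nD(W_0\|W_1)-\sqrt{2\phi''(0)\,r}\;n^{1-t}+o(n^{1-t}).$$ -/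

import Mathlib

open Filter Topology Asymptotics

namespace MarkovTesting

noncomputable section

/-- The Perron-Frobenius eigenvalue of an entrywise nonnegative matrix: the (largest) eigenvalue
that has a nonnegative nonzero eigenvector. For an irreducible matrix there is exactly one. -/
def perronEigenvalue {X : Type*} [Fintype X] (A : Matrix X X ℝ) : ℝ :=
  sSup {r : ℝ | ∃ v : X → ℝ, (∀ x, 0 ≤ v x) ∧ v ≠ 0 ∧ A.mulVec v = r • v}

/-- An ergodic (irreducible and aperiodic) transition matrix. The entry `W x y` is the conditional
probability `W(x | y)` of moving from `y` to `x`, so that the columns sum to one. -/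
structure IsErgodicTransition {X : Type*} [Fintype X] [DecidableEq X]
    (W : Matrix X X ℝ) : Prop where
  stochastic : W ∈ Matrix.colStochastic ℝ X
  irreducible : W.IsIrreducible
  aperiodic : ∀ (x : X) (d : ℕ), 2 ≤ d → ∃ k : ℕ, 0 < (W ^ k) x x ∧ ¬ d ∣ k

/-- The law of `(X₁, …, Xₙ₊₁)` for the Markov chain with initial distribution `P` and transition
matrix `W`; the coordinates of a path are numbered from `0` to `n`. -/
def pathLaw {X : Type*} (W : Matrix X X ℝ) (P : X → ℝ) (n : ℕ) (x : Fin (n + 1) → X) : ℝ :=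
  P (x 0) * ∏ i : Fin n, W (x i.succ) (x i.castSucc)

/-- The matrix `W(x | y) exp (θ g(x, y))`. -/
def tilted {X : Type*} (W : Matrix X X ℝ) (g : X → X → ℝ) (θ : ℝ) : Matrix X X ℝ :=
  Matrix.of fun x y => W x y * Real.exp (θ * g x y)

/-- The potential function: logarithm of the Perron-Frobenius eigenvalue of the tilted matrix. -/
def potential {X : Type*} [Fintype X] (W : Matrix X X ℝ) (g : X → X → ℝ) (θ : ℝ) : ℝ :=
  Real.log (perronEigenvalue (tilted W g θ))

/-- The potential function for the generator `g(x, y) = log (W₁(x | y) / W₀(x | y))`. The values of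
`g` where `W₀` vanishes are irrelevant. -/
def testPotential {X : Type*} [Fintype X] (W₀ W₁ : Matrix X X ℝ) : ℝ → ℝ :=
  potential W₀ fun x y => Real.log (W₁ x y / W₀ x y)

/-- `u ↦` logarithm of the Perron-Frobenius eigenvalue of `W(x | y) ^ u * V(x | y) ^ (1 - u)`. When
`W` and `V` have the same support, this matrix vanishes off the support for every real `u`. -/
def renyiPotential {X : Type*} [Fintype X] (W V : Matrix X X ℝ) (u : ℝ) : ℝ :=
  Real.log (perronEigenvalue (Matrix.of fun x y => W x y ^ u * V x y ^ (1 - u)))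

/-- The relative entropy `D(W ‖ V)` of transition matrices with the same support. -/
def relEntropy {X : Type*} [Fintype X] (W V : Matrix X X ℝ) : ℝ :=
  deriv (renyiPotential W V) 1

/-- `β_ε(P ‖ Q)`: the minimum over randomized tests `T` of the error probability `E_Q[1 - T]`
under the constraint `E_P[T] ≤ ε`. -/
def betaRandomized {Ω : Type*} [Fintype Ω] (ε : ℝ) (P Q : Ω → ℝ) : ℝ :=
  sInf {b : ℝ | ∃ T : Ω → ℝ, (∀ ω, T ω ∈ Set.Icc (0 : ℝ) 1) ∧ ∑ ω, P ω * T ω ≤ ε ∧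
    b = ∑ ω, Q ω * (1 - T ω)}

/-- `β_ε(P ‖ Q)` with deterministic tests: the minimum over sets `S` of `1 - Q(S)` under the
constraint `P(S) ≤ ε`. -/
def betaDeterministic {Ω : Type*} [Fintype Ω] (ε : ℝ) (P Q : Ω → ℝ) : ℝ :=
  sInf {b : ℝ | ∃ S : Finset Ω, ∑ ω ∈ S, P ω ≤ ε ∧ b = 1 - ∑ ω ∈ S, Q ω}

end

end MarkovTesting

/-!
Write `M` and `N` for the path laws of the chains with matrices `W₀` and `W₁`, and let `φ` be the
potential of the log-likelihood ratio `g = log (W₁ / W₀)`, `V = φ''(0)` and `D = -φ'(0)`.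

*The potential.* A stationary vector of `W₀` is a simple right eigenvector and the constant vector a
simple left eigenvector for the eigenvalue `1`. The implicit function theorem
(`exists_contDiffAt_eigenpair`) continues both to `C²` branches of eigenvectors of the tilted
matrices. They stay positive near `θ = 0`, which identifies the eigenvalue as the Perron-Frobenius
eigenvalue (`exists_perron_branch`). Differentiating the left eigenvalue equation shows that `V` is
the stationary mean of `(g(x, y) + h(x) - h(y) - m)²`, where `h` is the derivative of the left
eigenvectors; it vanishes only if the log-likelihood ratio is a constant plus a coboundary on the
support, which for stochastic matrices forces `W₀ = W₁` (`testPotential_properties`). The Rényi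
potential is `u ↦ φ(1 - u)`, so the relative entropy is `D`.

*Moderate deviations.* The sum of `M^{1-s} N^s` over all paths is the total mass of the path weights
of the tilted matrix, and the positive left eigenvector pins it to `exp (n φ(s))` up to constants
that are uniform near `s = 0` (`sum_pathLaw_tilted_bounds`). At the scale `s = σ n^{-t}` only the
quadratic Taylor term of `φ` matters, so that `(log N - log M + n D) / n^{1-t}` has the scaled
cumulant generating function `σ² V / 2` at speed `n^{1-2t}`. Chernoff's bound and Cramér's change of
measure give (`eventually_likelihoodRatio_bounds`)
`M(M ≤ e^{n D - n^{1-t} δ} N) = exp (-n^{1-2t} (δ² / (2 V) + o(1)))`.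

*Testing.* For every `b`, likelihood-ratio tests and the standard converse arguments bound both
error probabilities in terms of `M(M ≤ e^b N)`. The upper bounds are attained by deterministic tests
and the lower bounds hold for randomized ones, so a single argument covers both kinds of tests
(`tendsto_log_beta`, `isLittleO_log_beta`).
-/

namespace MarkovTesting

/-! ### Perron-Frobenius eigenvalues and eigenvectors near a stochastic matrix -/

section Perron

variable {X : Type*} [Fintype X]

open Matrix

/-- A positive left eigenvector has a positive product with every nonzero nonnegative vector, so its
eigenvalue is the only one with a nonnegative right eigenvector. -/
theorem perronEigenvalue_eq {A : Matrix X X ℝ} {u v : X → ℝ} {r : ℝ}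
    (hu : ∀ x, 0 < u x) (huA : u ᵥ* A = r • u)
    (hv : ∀ x, 0 ≤ v x) (hv0 : v ≠ 0) (hAv : A *ᵥ v = r • v) :
    perronEigenvalue A = r := by
  have key : {r : ℝ | ∃ v : X → ℝ, (∀ x, 0 ≤ v x) ∧ v ≠ 0 ∧ A.mulVec v = r • v} = {r} := by
    ext q
    simp only [Set.mem_ofPred_eq, Set.mem_singleton_iff]
    constructor
    · rintro ⟨w, hw, hw0, hAw⟩
      have h : r * (u ⬝ᵥ w) = q * (u ⬝ᵥ w) := by
        have := dotProduct_mulVec u A w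
        rw [huA, hAw, dotProduct_smul, smul_dotProduct] at this
        exact this.symm
      obtain ⟨x, hx⟩ := Function.ne_iff.mp hw0
      have hpos : 0 < u ⬝ᵥ w := Finset.sum_pos' (fun y _ => mul_nonneg (hu y).le (hw y))
        ⟨x, Finset.mem_univ x, mul_pos (hu x) (lt_of_le_of_ne (hw x) (Ne.symm hx))⟩
      exact (mul_right_cancel₀ hpos.ne' h).symm
    · rintro rfl
      exact ⟨v, hv, hv0, hAv⟩
  rw [perronEigenvalue, key, csSup_singleton]

theorem eq_zero_of_fixed_of_apply_eq_zero [DecidableEq X] {A : Matrix X X ℝ}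
    (hA : A.IsIrreducible) {v : X → ℝ} (hv : ∀ x, 0 ≤ v x) (hAv : A *ᵥ v = v) {x : X}
    (hx : v x = 0) : v = 0 := by
  have hpow : ∀ k : ℕ, (A ^ k) *ᵥ v = v := by
    intro k
    induction k with
    | zero => simp
    | succ k ih => rw [pow_succ, ← mulVec_mulVec, hAv, ih]
  funext y
  obtain ⟨k, -, hk⟩ := (isIrreducible_iff_exists_pow_pos hA.nonneg).mp hA x y
  have hle : (A ^ k) x y * v y ≤ ((A ^ k) *ᵥ v) x :=
    Finset.single_le_sum (f := fun y => (A ^ k) x y * v y)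
      (fun z _ => mul_nonneg (pow_apply_nonneg hA.nonneg k x z) (hv z)) (Finset.mem_univ y)
  rw [hpow, hx] at hle
  exact le_antisymm (nonpos_of_mul_nonpos_right hle hk) (hv y)

theorem exists_eq_smul_of_fixed [DecidableEq X] {A : Matrix X X ℝ}
    (hA : A.IsIrreducible) {w v : X → ℝ} (hw : ∀ x, 0 < w x) (hAw : A *ᵥ w = w)
    (hAv : A *ᵥ v = v) : ∃ c : ℝ, v = c • w := by
  cases isEmpty_or_nonempty X
  · exact ⟨0, Subsingleton.elim _ _⟩
  -- subtracting the largest multiple of `w` below `v` leaves a nonnegative vector with a zero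
  obtain ⟨x, hx⟩ := Finite.exists_min fun x => v x / w x
  refine ⟨v x / w x, ?_⟩
  rw [← sub_eq_zero]
  refine eq_zero_of_fixed_of_apply_eq_zero hA (x := x) (fun y => ?_) ?_ ?_
  · simpa [sub_nonneg] using (le_div_iff₀ (hw y)).mp (hx y)
  · rw [mulVec_sub, mulVec_smul, hAw, hAv]
  · simp [(hw x).ne']

/-- Since the columns of `W` sum to one, `W - 1` is singular and there is a signed fixed vector `v`.
The inequality `|v| ≤ W |v|` is an equality because `W` preserves the total mass, so `|v|` is fixed
too, and irreducibility makes it positive. -/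
theorem exists_stationary [DecidableEq X] [Nonempty X] {W : Matrix X X ℝ}
    (hW : W ∈ colStochastic ℝ X) (hirr : W.IsIrreducible) :
    ∃ p : X → ℝ, (∀ x, 0 < p x) ∧ W *ᵥ p = p ∧ ∑ x, p x = 1 := by
  have h1 : (1 : X → ℝ) ᵥ* W = 1 := one_vecMul_of_mem_colStochastic hW
  have hdet : (W - 1).det = 0 :=
    exists_vecMul_eq_zero_iff.mp ⟨1, one_ne_zero, by rw [vecMul_sub, h1, vecMul_one, sub_self]⟩
  obtain ⟨v, hv0, hv⟩ := exists_mulVec_eq_zero_iff.mpr hdet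
  rw [sub_mulVec, one_mulVec, sub_eq_zero] at hv
  have hle : ∀ x ∈ Finset.univ, |v x| ≤ (W *ᵥ |v|) x := by
    intro x _
    conv_lhs => rw [← hv]
    refine (Finset.abs_sum_le_sum_abs _ _).trans (Finset.sum_le_sum fun y _ => ?_)
    rw [abs_mul, abs_of_nonneg (hirr.nonneg x y), Pi.abs_apply]
  have habs : W *ᵥ |v| = |v| := by
    funext x
    refine ((Finset.sum_eq_sum_iff_of_le hle).mp ?_ x (Finset.mem_univ x)).symm
    exact (sum_mulVec_of_mem_colStochastic hW).symm
  have hpos : ∀ x, 0 < |v| x := by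
    intro x
    refine lt_of_le_of_ne (abs_nonneg _) fun h => hv0 ?_
    have hv0 := eq_zero_of_fixed_of_apply_eq_zero hirr (fun y => by simp) habs h.symm
    exact funext fun y => abs_eq_zero.mp (congrFun hv0 y)
  have hs : 0 < ∑ x, |v| x := Finset.sum_pos (fun x _ => hpos x) Finset.univ_nonempty
  refine ⟨(∑ x, |v| x)⁻¹ • |v|, fun x => ?_, ?_, ?_⟩
  · exact mul_pos (inv_pos.mpr hs) (hpos x)
  · rw [mulVec_smul, habs]
  · simp only [Pi.smul_apply, smul_eq_mul, ← Finset.mul_sum]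
    exact inv_mul_cancel₀ hs.ne'

/-- A simple eigenvalue `1` of `B 0`, with right eigenvector `w` and left eigenvector `z`, extends
to a branch of eigenvalues of `B s` that is as smooth as `B`, with eigenvectors normalized by
`z ⬝ᵥ u s = 1`. This is the implicit function theorem for
`(s, l, u) ↦ (z ⬝ᵥ u, B s *ᵥ u - l • u)`. -/
theorem exists_contDiffAt_eigenpair {B : ℝ → Matrix X X ℝ}
    (hB : ∀ x y, ContDiff ℝ 2 fun s => B s x y) {w z : X → ℝ} (hw : B 0 *ᵥ w = w)
    (hz : z ᵥ* B 0 = z) (hzw : z ⬝ᵥ w = 1)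
    (huniq : ∀ v, B 0 *ᵥ v = v → ∃ c : ℝ, v = c • w) :
    ∃ (l : ℝ → ℝ) (u : ℝ → X → ℝ), ContDiffAt ℝ 2 l 0 ∧ ContDiffAt ℝ 2 u 0 ∧ l 0 = 1 ∧ u 0 = w ∧
      ∀ᶠ s in 𝓝 0, z ⬝ᵥ u s = 1 ∧ B s *ᵥ u s = l s • u s := by
  let f : ℝ × (ℝ × (X → ℝ)) → ℝ × (X → ℝ) := fun p =>
    (∑ x, z x * p.2.2 x, fun x => ∑ y, B p.1 x y * p.2.2 y - p.2.1 * p.2.2 x)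
  have hf : ContDiff ℝ 2 f := by
    have hB' : ∀ x y, ContDiff ℝ 2 fun p : ℝ × (ℝ × (X → ℝ)) => B p.1 x y :=
      fun x y => (hB x y).comp contDiff_fst
    fun_prop
  have hfa : ContDiffAt ℝ 2 f (0, (1, w)) := hf.contDiffAt
  set L := fderiv ℝ f (0, (1, w)) ∘L .inr ℝ ℝ (ℝ × (X → ℝ)) with hL
  have hLq : ∀ q, L q =
      (∑ x, z x * q.2 x, fun x => ∑ y, B 0 x y * q.2 y - (q.1 * w x + q.2 x)) := by
    intro q
    have hline : HasDerivAt (fun e : ℝ => ((0, (1, w)) + e • (0, q) : ℝ × (ℝ × (X → ℝ))))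
        (0, q) 0 := by
      simpa using ((hasDerivAt_id (0 : ℝ)).smul_const ((0, q) : ℝ × (ℝ × (X → ℝ)))).const_add
        ((0, (1, w)) : ℝ × (ℝ × (X → ℝ)))
    have h1 : HasDerivAt (fun e : ℝ => f ((0, (1, w)) + e • (0, q))) (L q) 0 := by
      have := (hfa.differentiableAt (by norm_num)).hasFDerivAt
      refine HasFDerivAt.comp_hasDerivAt (0 : ℝ) (l := f) (l' := fderiv ℝ f (0, (1, w))) ?_ hline
      simpa using this
    have hlin : ∀ x, HasDerivAt (fun e : ℝ => w x + e * q.2 x) (q.2 x) 0 := fun x => by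
      simpa using ((hasDerivAt_id (0 : ℝ)).mul_const (q.2 x)).const_add (w x)
    refine h1.unique (HasDerivAt.prodMk ?_ (hasDerivAt_pi.mpr fun x => ?_))
    · simpa using HasDerivAt.fun_sum fun x (_ : x ∈ Finset.univ) => (hlin x).const_mul (z x)
    · have h2 := (HasDerivAt.fun_sum fun y (_ : y ∈ Finset.univ) => (hlin y).const_mul (B 0 x y))
      have h3 : HasDerivAt (fun e : ℝ => 1 + e * q.1) q.1 0 := by
        simpa using ((hasDerivAt_id (0 : ℝ)).mul_const q.1).const_add 1
      simpa [Pi.sub_def, Pi.mul_def] using h2.sub (h3.mul (hlin x))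
  -- pairing with the left eigenvector `z` shows that the eigenvalue component vanishes
  have hinj : Function.Injective L := by
    rw [injective_iff_map_eq_zero]
    rintro ⟨m, v⟩ hq
    rw [hLq, Prod.mk_eq_zero] at hq
    obtain ⟨hq1, hq2⟩ := hq
    have hq2' : B 0 *ᵥ v = m • w + v := by
      funext x
      exact sub_eq_zero.mp (congrFun hq2 x)
    have hzv : z ⬝ᵥ v = 0 := hq1
    have hm : m = 0 := by
      have := dotProduct_mulVec z (B 0) v
      rw [hz, hq2', dotProduct_add, dotProduct_smul, hzw, hzv] at this
      simpa using this
    subst hm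
    rw [zero_smul, zero_add] at hq2'
    obtain ⟨c, rfl⟩ := huniq v hq2'
    rw [dotProduct_smul, hzw, smul_eq_mul, mul_one] at hzv
    simp [hzv]
  have hinv : L.IsInvertible :=
    ⟨(LinearEquiv.ofInjectiveEndo
        (L : ℝ × (X → ℝ) →ₗ[ℝ] ℝ × (X → ℝ)) hinj).toContinuousLinearEquiv, by ext <;> rfl⟩
  have h2 : (2 : WithTop ℕ∞) ≠ 0 := by norm_num
  set ψ := hfa.implicitFunction h2 hinv
  have hψ : ContDiffAt ℝ 2 ψ 0 := hfa.contDiffAt_implicitFunction h2 hinv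
  have hψ0 : ψ 0 = (1, w) := hfa.implicitFunction_apply_self h2 hinv
  have hψe : ∀ᶠ s in 𝓝 (0 : ℝ), f (s, ψ s) = f (0, (1, w)) :=
    hfa.eventually_apply_implicitFunction h2 hinv
  have hf0 : f (0, (1, w)) = (1, 0) := by
    refine Prod.ext hzw (funext fun x => ?_)
    have := congrFun hw x
    simp only [mulVec, dotProduct] at this
    simp [f, this]
  refine ⟨fun s => (ψ s).1, fun s => (ψ s).2, hψ.fst, hψ.snd, by simp [hψ0], by simp [hψ0], ?_⟩
  filter_upwards [hψe] with s hs
  rw [hf0] at hs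
  exact ⟨congrArg Prod.fst hs, funext fun x => sub_eq_zero.mp (congrFun (congrArg Prod.snd hs) x)⟩

end Perron

/-! ### Second-order Taylor expansion -/

section Smoothness

theorem eventually_hasDerivAt_deriv {f : ℝ → ℝ} {a : ℝ} (hf : ContDiffAt ℝ 2 f a) :
    ∀ᶠ s in 𝓝 a, HasDerivAt f (deriv f s) s := by
  filter_upwards [hf.eventually (by simp)] with s hs
  exact (hs.differentiableAt (by norm_num)).hasDerivAt

theorem hasDerivAt_deriv_iteratedDeriv_two {f : ℝ → ℝ} {a : ℝ} (hf : ContDiffAt ℝ 2 f a) :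
    HasDerivAt (deriv f) (iteratedDeriv 2 f a) a := by
  have h1 : ContDiffAt ℝ 1 (deriv f) a := by
    have := hf.fderiv_right (m := 1) (by norm_num)
    exact this.clm_apply contDiffAt_const
  rw [iteratedDeriv_succ, iteratedDeriv_one]
  exact (h1.differentiableAt (by norm_num)).hasDerivAt

theorem isLittleO_sub_taylor_two {f : ℝ → ℝ} (hf : ContDiffAt ℝ 2 f 0) :
    (fun s => f s - (f 0 + s * deriv f 0 + s ^ 2 / 2 * iteratedDeriv 2 f 0))
      =o[𝓝 0] fun s => s ^ 2 := by
  obtain ⟨r, hr, hball⟩ := Metric.eventually_nhds_iff_ball.mp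
    (eventually_hasDerivAt_deriv hf)
  have h0 : (0 : ℝ) ∈ Metric.ball (0 : ℝ) r := Metric.mem_ball_self hr
  have hN : 𝓝[Metric.ball (0 : ℝ) r] 0 = 𝓝 0 := Metric.isOpen_ball.nhdsWithin_eq h0
  have key := Convex.isLittleO_pow_succ_real (n := 1) (convex_ball (0 : ℝ) r) h0
    (f := fun s => f s - (f 0 + s * deriv f 0 + s ^ 2 / 2 * iteratedDeriv 2 f 0))
    (f' := fun s => deriv f s - (deriv f 0 + s * iteratedDeriv 2 f 0)) ?_ ?_
  · rw [hN] at key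
    simpa using key
  · intro s hs
    have h1 : HasDerivAt (fun s : ℝ => f 0 + s * deriv f 0 + s ^ 2 / 2 * iteratedDeriv 2 f 0)
        (deriv f 0 + s * iteratedDeriv 2 f 0) s := by
      have := (((hasDerivAt_id s).mul_const (deriv f 0)).const_add (f 0)).add
        ((((hasDerivAt_id s).pow 2).div_const 2).mul_const (iteratedDeriv 2 f 0))
      refine this.congr_deriv ?_
      simp
    exact ((hball s hs).sub h1).hasDerivWithinAt
  · rw [hN]
    have := (hasDerivAt_iff_isLittleO.mp (hasDerivAt_deriv_iteratedDeriv_two hf))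
    refine (this.congr_left fun s => ?_).congr_right fun s => ?_
    · simp only [sub_zero, smul_eq_mul]; ring
    · simp

end Smoothness

/-! ### The potential near zero -/

section Branch

open Matrix

variable {X : Type*} [Fintype X]

/-- Near `θ = 0` the Perron-Frobenius eigenvalue of the tilted matrices is a `C²` branch `l` of
simple eigenvalues, with a `C²` branch `u` of positive left eigenvectors starting at `1`. -/
theorem exists_perron_branch [DecidableEq X] [Nonempty X] {W : Matrix X X ℝ}
    (hW : W ∈ colStochastic ℝ X) (hirr : W.IsIrreducible) (g : X → X → ℝ) {p : X → ℝ}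
    (hp : ∀ x, 0 < p x) (hWp : W *ᵥ p = p) (hp1 : ∑ x, p x = 1) :
    ∃ (l : ℝ → ℝ) (u : ℝ → X → ℝ), ContDiffAt ℝ 2 l 0 ∧ ContDiffAt ℝ 2 u 0 ∧ l 0 = 1 ∧ u 0 = 1 ∧
      (∀ᶠ s in 𝓝 0, p ⬝ᵥ u s = 1 ∧ u s ᵥ* tilted W g s = l s • u s) ∧
      ∀ᶠ s in 𝓝 0, perronEigenvalue (tilted W g s) = l s := by
  have h1 : (1 : X → ℝ) ᵥ* W = 1 := one_vecMul_of_mem_colStochastic hW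
  have hT0 : tilted W g 0 = W := by ext; simp [tilted]
  have hpp : p ⬝ᵥ 1 = 1 := by simpa [dotProduct] using hp1
  have hB : ∀ x y, ContDiff ℝ 2 fun s => tilted W g s x y := by
    intro x y; simp only [tilted, of_apply]; fun_prop
  obtain ⟨l', v, -, hv, -, hv0, hve⟩ := exists_contDiffAt_eigenpair (B := tilted W g) hB
    (w := p) (z := 1) (by rw [hT0, hWp]) (by rw [hT0, h1]) (by rw [dotProduct_comm, hpp])
    (fun q hq => exists_eq_smul_of_fixed hirr hp hWp (by rwa [hT0] at hq))
  obtain ⟨l, u, hl, hu, hl0, hu0, hue⟩ := exists_contDiffAt_eigenpair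
    (B := fun s => (tilted W g s)ᵀ) (fun x y => hB y x)
    (w := 1) (z := p) (by rw [hT0, mulVec_transpose, h1])
    (by rw [hT0, vecMul_transpose, hWp]) hpp
    (fun q hq => exists_eq_smul_of_fixed hirr.transpose (fun _ => one_pos)
      (by rw [mulVec_transpose, h1]) (by rwa [hT0] at hq))
  have hue' : ∀ᶠ s in 𝓝 0, p ⬝ᵥ u s = 1 ∧ u s ᵥ* tilted W g s = l s • u s := by
    simpa only [mulVec_transpose] using hue
  have hupos : ∀ᶠ s in 𝓝 0, ∀ x, 0 < u s x := eventually_all.mpr fun x =>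
    ((continuous_apply x).continuousAt.comp hu.continuousAt).eventually_const_lt
      (by simp [hu0])
  have hvpos : ∀ᶠ s in 𝓝 0, ∀ x, 0 < v s x := eventually_all.mpr fun x =>
    ((continuous_apply x).continuousAt.comp hv.continuousAt).eventually_const_lt
      (by simpa [hv0] using hp x)
  refine ⟨l, u, hl, hu, hl0, hu0, hue', ?_⟩
  filter_upwards [hue', hve, hupos, hvpos] with s hs hs' hus hvs
  -- left and right eigenvectors that are not orthogonal belong to the same eigenvalue
  have hpos : 0 < u s ⬝ᵥ v s :=
    Finset.sum_pos (fun x _ => mul_pos (hus x) (hvs x)) Finset.univ_nonempty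
  have hll : l s = l' s := by
    have := dotProduct_mulVec (u s) (tilted W g s) (v s)
    rw [hs.2, hs'.2, dotProduct_smul, smul_dotProduct] at this
    exact (mul_right_cancel₀ hpos.ne' this).symm
  refine perronEigenvalue_eq hus hs.2 (fun x => (hvs x).le) (fun h => ?_) (hll ▸ hs'.2)
  simp [h] at hpos

/-- Expansion of the mean square of the martingale increment `g(x, y) + h(x) - h(y) - m` in a
stationary chain. -/
theorem sum_martingale_increment_sq {W : Matrix X X ℝ} {p h : X → ℝ} {g : X → X → ℝ} {m : ℝ}
    (hW : ∀ y, ∑ x, W x y = 1) (hWp : ∀ x, ∑ y, W x y * p y = p x) (hp : ∑ x, p x = 1)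
    (hh : ∑ x, p x * h x = 0) (hmart : ∀ y, ∑ x, W x y * (h x + g x y) = m + h y) :
    ∑ y, p y * ∑ x, W x y * (g x y + h x - h y - m) ^ 2 =
      ∑ y, p y * ∑ x, W x y * (2 * (h x * g x y) + g x y ^ 2) - m ^ 2 := by
  have h1 : ∀ y, ∑ x, W x y * (g x y + h x - h y - m) ^ 2 =
      ∑ x, W x y * (2 * (h x * g x y) + g x y ^ 2) + ∑ x, W x y * h x ^ 2 - (m + h y) ^ 2 := by
    intro y
    have e : ∀ x, W x y * (g x y + h x - h y - m) ^ 2 =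
        W x y * (2 * (h x * g x y) + g x y ^ 2) + W x y * h x ^ 2
          - 2 * (m + h y) * (W x y * (h x + g x y)) + (m + h y) ^ 2 * W x y := fun x => by ring
    simp only [e, Finset.sum_add_distrib, Finset.sum_sub_distrib, ← Finset.mul_sum, hmart, hW]
    ring
  have h2 : ∑ y, p y * ∑ x, W x y * h x ^ 2 = ∑ x, p x * h x ^ 2 := by
    simp only [Finset.mul_sum]
    rw [Finset.sum_comm]
    refine Finset.sum_congr rfl fun x _ => ?_
    rw [← hWp x, Finset.sum_mul]
    exact Finset.sum_congr rfl fun y _ => by ring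
  have h3 : ∑ y, p y * (m + h y) ^ 2 = m ^ 2 + ∑ x, p x * h x ^ 2 := by
    have e : ∀ y, p y * (m + h y) ^ 2 = m ^ 2 * p y + 2 * m * (p y * h y) + p y * h y ^ 2 :=
      fun y => by ring
    simp only [e, Finset.sum_add_distrib, ← Finset.mul_sum, hp, hh]
    ring
  simp only [h1, mul_sub, mul_add, Finset.sum_add_distrib, Finset.sum_sub_distrib] at *
  linarith

/-- The potential is `C²` at `0`, and its second derivative is the mean square of a martingale
increment obtained from `g` by adding the coboundary of the derivative `h` of the left
eigenvectors. -/
theorem potential_contDiffAt_and_iteratedDeriv_two [DecidableEq X] [Nonempty X] {W : Matrix X X ℝ}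
    (hW : W ∈ colStochastic ℝ X) (hirr : W.IsIrreducible) (g : X → X → ℝ) {p : X → ℝ}
    (hp : ∀ x, 0 < p x) (hWp : W *ᵥ p = p) (hp1 : ∑ x, p x = 1) :
    potential W g 0 = 0 ∧ ContDiffAt ℝ 2 (potential W g) 0 ∧ ∃ (h : X → ℝ) (m : ℝ),
      iteratedDeriv 2 (potential W g) 0 =
        ∑ y, p y * ∑ x, W x y * (g x y + h x - h y - m) ^ 2 := by
  obtain ⟨l, u, hl, hu, hl0, hu0, hue, hle⟩ := exists_perron_branch hW hirr g hp hWp hp1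
  have hφ : potential W g =ᶠ[𝓝 0] fun s => Real.log (l s) := by
    filter_upwards [hle] with s hs
    rw [potential, hs]
  have hφc : ContDiffAt ℝ 2 (potential W g) 0 :=
    (hl.log (by simp [hl0])).congr_of_eventuallyEq hφ
  refine ⟨by rw [hφ.eq_of_nhds, hl0, Real.log_one], hφc, ?_⟩
  have hux : ∀ x, ContDiffAt ℝ 2 (fun s => u s x) 0 := fun x => contDiffAt_pi.mp hu x
  have hu1 : ∀ x, HasDerivAt (fun s => u s x) (deriv (fun s => u s x) 0) 0 := fun x =>
    (eventually_hasDerivAt_deriv (hux x)).self_of_nhds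
  have hl1 : HasDerivAt l (deriv l 0) 0 :=
    (eventually_hasDerivAt_deriv hl).self_of_nhds
  have hexp : ∀ c s : ℝ, HasDerivAt (fun s => Real.exp (s * c)) (Real.exp (s * c) * c) s := by
    intro c s
    simpa using ((hasDerivAt_id s).mul_const c).exp
  set h : X → ℝ := fun x => deriv (fun s => u s x) 0 with hh
  set m := deriv l 0 with hm
  have hWs : ∀ y, ∑ x, W x y = 1 := fun y => sum_col_of_mem_colStochastic hW y
  have hWps : ∀ x, ∑ y, W x y * p y = p x := fun x => congrFun hWp x
  have hph : ∑ x, p x * h x = 0 := by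
    have h1 : HasDerivAt (fun s => ∑ x, p x * u s x) (∑ x, p x * h x) 0 :=
      HasDerivAt.fun_sum fun x _ => (hu1 x).const_mul (p x)
    refine h1.unique ((hasDerivAt_const (0 : ℝ) (1 : ℝ)).congr_of_eventuallyEq ?_)
    filter_upwards [hue] with s hs using hs.1
  have hmart : ∀ y, ∑ x, W x y * (h x + g x y) = m + h y := by
    intro y
    have h1 : HasDerivAt (fun s => ∑ x, u s x * (W x y * Real.exp (s * g x y)))
        (∑ x, (h x * (W x y * Real.exp (0 * g x y)) +
          u 0 x * (W x y * (Real.exp (0 * g x y) * g x y)))) 0 :=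
      HasDerivAt.fun_sum fun x _ => (hu1 x).mul ((hexp (g x y) 0).const_mul (W x y))
    have h2 : HasDerivAt (fun s => l s * u s y) (m * u 0 y + l 0 * h y) 0 := hl1.mul (hu1 y)
    have h3 := h1.unique (h2.congr_of_eventuallyEq (by
      filter_upwards [hue] with s hs using congrFun hs.2 y))
    simp only [hu0, hl0, zero_mul, Real.exp_zero, Pi.one_apply, one_mul, mul_one] at h3
    rw [← h3]
    exact Finset.sum_congr rfl fun x _ => by ring
  -- pairing the eigenvalue equation with the stationary vector leaves only `exp (s g) - 1`,
  -- so that second derivatives of the eigenvectors do not enter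
  have hl_eq : l =ᶠ[𝓝 0] fun s =>
      1 + ∑ y, p y * ∑ x, W x y * (u s x * (Real.exp (s * g x y) - 1)) := by
    filter_upwards [hue] with s hs
    have h1 : ∑ y, p y * ∑ x, W x y * (u s x * Real.exp (s * g x y)) = l s := by
      have : ∀ y, ∑ x, W x y * (u s x * Real.exp (s * g x y)) = l s * u s y := fun y => by
        rw [← smul_eq_mul (l s), ← Pi.smul_apply, ← hs.2]
        exact Finset.sum_congr rfl fun x _ => by simp only [tilted, of_apply]; ring
      simp only [this, mul_left_comm _ (l s), ← Finset.mul_sum]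
      rw [show ∑ y, p y * u s y = 1 from hs.1, mul_one]
    have h2 : ∑ y, p y * ∑ x, W x y * u s x = 1 := by
      rw [← hs.1, dotProduct]
      simp only [Finset.mul_sum]
      rw [Finset.sum_comm]
      refine Finset.sum_congr rfl fun x _ => ?_
      rw [← hWps x, Finset.sum_mul]
      exact Finset.sum_congr rfl fun y _ => by ring
    simp only [mul_sub, mul_one, Finset.sum_sub_distrib, h1, h2]
    ring
  have hdl : deriv l =ᶠ[𝓝 0] fun s => ∑ y, p y * ∑ x, W x y *
      (deriv (fun s => u s x) s * (Real.exp (s * g x y) - 1) +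
        u s x * (Real.exp (s * g x y) * g x y)) := by
    filter_upwards [hl_eq.eventuallyEq_nhds, eventually_all.mpr fun x =>
      eventually_hasDerivAt_deriv (hux x)] with s hs hus
    rw [hs.deriv_eq]
    exact (HasDerivAt.const_add 1 (HasDerivAt.fun_sum fun y _ => HasDerivAt.const_mul (p y)
      (HasDerivAt.fun_sum fun x _ => HasDerivAt.const_mul (W x y)
        ((hus x).mul ((hexp (g x y) s).sub_const 1))))).deriv
  have hddl : HasDerivAt (deriv l)
      (∑ y, p y * ∑ x, W x y * (2 * (h x * g x y) + g x y ^ 2)) 0 := by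
    refine HasDerivAt.congr_of_eventuallyEq ?_ hdl
    refine HasDerivAt.fun_sum fun y _ => HasDerivAt.const_mul (p y)
      (HasDerivAt.fun_sum fun x _ => HasDerivAt.const_mul (W x y) ?_)
    have := ((hasDerivAt_deriv_iteratedDeriv_two (hux x)).mul ((hexp (g x y) 0).sub_const 1)).add
      ((hu1 x).mul ((hexp (g x y) 0).mul_const (g x y)))
    refine this.congr_deriv ?_
    simp only [hu0, hh, zero_mul, Real.exp_zero, Pi.one_apply]
    ring
  refine ⟨h, m, ?_⟩
  rw [sum_martingale_increment_sq hWs hWps hp1 hph hmart]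
  refine (hasDerivAt_deriv_iteratedDeriv_two hφc).unique ?_
  have hdφ : deriv (potential W g) =ᶠ[𝓝 0] fun s => deriv l s / l s := by
    filter_upwards [hφ.eventuallyEq_nhds, eventually_hasDerivAt_deriv hl,
      hl.continuousAt.eventually_ne (y := 0) (by simp [hl0])] with s hs hls hs0
    rw [hs.deriv_eq]
    exact (hls.log hs0).deriv
  refine ((hddl.div hl1 (by simp [hl0])).congr_of_eventuallyEq hdφ).congr_deriv ?_
  simp only [hl0]
  ring

end Branch

/-! ### The potential of the log-likelihood ratio -/

section TestPotential

open Matrix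

variable {X : Type*} [Fintype X] {W₀ W₁ : Matrix X X ℝ}

/-- If the second derivative vanished, the log-likelihood ratio would be a constant plus a
coboundary on the support, which makes `exp h` a left eigenvector of `W₁`; then `h` and the
constant are trivial and the chains agree. -/
theorem testPotential_properties [DecidableEq X] [Nonempty X] (hW₀ : W₀ ∈ colStochastic ℝ X)
    (hirr₀ : W₀.IsIrreducible) (hW₁ : W₁ ∈ colStochastic ℝ X) (hirr₁ : W₁.IsIrreducible)
    (hsupp : ∀ x y, 0 < W₀ x y ↔ 0 < W₁ x y) (hne : W₀ ≠ W₁) :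
    testPotential W₀ W₁ 0 = 0 ∧ ContDiffAt ℝ 2 (testPotential W₀ W₁) 0 ∧
      0 < iteratedDeriv 2 (testPotential W₀ W₁) 0 := by
  obtain ⟨p, hp, hWp, hp1⟩ := exists_stationary hW₀ hirr₀
  obtain ⟨h0, hc, h, m, hV⟩ := potential_contDiffAt_and_iteratedDeriv_two hW₀ hirr₀
    (fun x y => Real.log (W₁ x y / W₀ x y)) hp hWp hp1
  refine ⟨h0, hc, lt_of_le_of_ne ?_ fun hV0 => hne ?_⟩
  · rw [testPotential, hV]
    exact Finset.sum_nonneg fun y _ => mul_nonneg (hp y).le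
      (Finset.sum_nonneg fun x _ => mul_nonneg (hirr₀.nonneg x y) (sq_nonneg _))
  rw [testPotential, hV, eq_comm, Finset.sum_eq_zero_iff_of_nonneg fun y _ => mul_nonneg (hp y).le
      (Finset.sum_nonneg fun x _ => mul_nonneg (hirr₀.nonneg x y) (sq_nonneg _))] at hV0
  have hW₁_eq : ∀ x y, W₁ x y * Real.exp (h x) = Real.exp m * Real.exp (h y) * W₀ x y := by
    intro x y
    rcases (hirr₀.nonneg x y).eq_or_lt with h00 | hpos
    · have h10 : W₁ x y = 0 := le_antisymm
        (not_lt.mp fun hc => by have := (hsupp x y).mpr hc; linarith) (hirr₁.nonneg x y)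
      rw [h10, ← h00, zero_mul, mul_zero]
    · have hpos₁ := (hsupp x y).mp hpos
      have h1 := (mul_eq_zero.mp (hV0 y (Finset.mem_univ y))).resolve_left (hp y).ne'
      rw [Finset.sum_eq_zero_iff_of_nonneg
        fun x _ => mul_nonneg (hirr₀.nonneg x y) (sq_nonneg _)] at h1
      have h2 := (mul_eq_zero.mp (h1 x (Finset.mem_univ x))).resolve_left hpos.ne'
      have h3 : Real.log (W₁ x y / W₀ x y) = m + h y - h x := by
        have := pow_eq_zero_iff (two_ne_zero) |>.mp h2
        linarith
      have h4 : W₁ x y / W₀ x y = Real.exp m * Real.exp (h y) / Real.exp (h x) := by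
        rw [← Real.exp_add, ← Real.exp_sub, ← h3, Real.exp_log (div_pos hpos₁ hpos)]
      rw [div_eq_div_iff hpos.ne' (Real.exp_pos _).ne'] at h4
      exact h4
  have heig : (fun x => Real.exp (h x)) ᵥ* W₁ = Real.exp m • fun x => Real.exp (h x) := by
    funext y
    have : ∀ x, Real.exp (h x) * W₁ x y = Real.exp m * Real.exp (h y) * W₀ x y := fun x => by
      rw [mul_comm, hW₁_eq]
    simp only [vecMul, dotProduct, this, ← Finset.mul_sum, sum_col_of_mem_colStochastic hW₀,
      Pi.smul_apply, smul_eq_mul, mul_one]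
  obtain ⟨q, hq, hWq, -⟩ := exists_stationary hW₁ hirr₁
  have hm : Real.exp m = 1 := by
    have hpos : 0 < (fun x => Real.exp (h x)) ⬝ᵥ q :=
      Finset.sum_pos (fun x _ => mul_pos (Real.exp_pos _) (hq x)) Finset.univ_nonempty
    have := dotProduct_mulVec (fun x => Real.exp (h x)) W₁ q
    rw [heig, hWq, smul_dotProduct, smul_eq_mul] at this
    exact mul_right_cancel₀ hpos.ne' (by rw [one_mul, ← this])
  rw [hm, one_smul, ← mulVec_transpose] at heig
  obtain ⟨c, hc⟩ := exists_eq_smul_of_fixed hirr₁.transpose (w := 1) (fun _ => one_pos)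
    (by rw [mulVec_transpose]; exact one_vecMul_of_mem_colStochastic hW₁) heig
  have hconst : ∀ x, Real.exp (h x) = c := fun x => by simpa using congrFun hc x
  ext x y
  have := hW₁_eq x y
  rw [hm, one_mul, hconst, hconst, mul_comm] at this
  exact (mul_left_cancel₀ (hconst x ▸ (Real.exp_pos (h x)).ne') this).symm

theorem renyiPotential_eq (hnn₀ : ∀ x y, 0 ≤ W₀ x y) (hnn₁ : ∀ x y, 0 ≤ W₁ x y)
    (hsupp : ∀ x y, 0 < W₀ x y ↔ 0 < W₁ x y) (u : ℝ) :
    renyiPotential W₀ W₁ u = testPotential W₀ W₁ (1 - u) := by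
  rw [renyiPotential, testPotential, potential]
  congr 2
  ext x y
  simp only [tilted, of_apply]
  rcases (hnn₀ x y).eq_or_lt with h00 | hpos
  · have h10 : W₁ x y = 0 := le_antisymm
      (not_lt.mp fun hc => by have := (hsupp x y).mpr hc; linarith) (hnn₁ x y)
    rw [h10, ← h00, zero_mul]
    rcases eq_or_ne u 0 with rfl | hu
    · simp
    · rw [Real.zero_rpow hu, zero_mul]
  · have hpos₁ := (hsupp x y).mp hpos
    rw [Real.rpow_def_of_pos hpos, Real.rpow_def_of_pos hpos₁, Real.log_div hpos₁.ne' hpos.ne',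
      ← Real.exp_add]
    nth_rw 2 [← Real.exp_log hpos]
    rw [← Real.exp_add]
    ring_nf

theorem renyiPotential_differentiableAt_and_relEntropy (hnn₀ : ∀ x y, 0 ≤ W₀ x y)
    (hnn₁ : ∀ x y, 0 ≤ W₁ x y) (hsupp : ∀ x y, 0 < W₀ x y ↔ 0 < W₁ x y)
    (hφ : DifferentiableAt ℝ (testPotential W₀ W₁) 0) :
    DifferentiableAt ℝ (renyiPotential W₀ W₁) 1 ∧
      relEntropy W₀ W₁ = -deriv (testPotential W₀ W₁) 0 := by
  have h1 : HasDerivAt (renyiPotential W₀ W₁) (-deriv (testPotential W₀ W₁) 0) 1 := by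
    have h2 : HasDerivAt (fun u : ℝ => 1 - u) (-1) 1 := by
      simpa using (hasDerivAt_id (1 : ℝ)).const_sub 1
    have h3 : HasDerivAt (testPotential W₀ W₁) (deriv (testPotential W₀ W₁) 0) (1 - 1) := by
      rw [sub_self]; exact hφ.hasDerivAt
    have h4 := HasDerivAt.comp (1 : ℝ) h3 h2
    rw [mul_neg_one] at h4
    exact h4.congr_of_eventuallyEq
      (Eventually.of_forall fun u => renyiPotential_eq hnn₀ hnn₁ hsupp u)
  exact ⟨h1.differentiableAt, h1.deriv⟩

end TestPotential

/-! ### Total mass of path weights -/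

section PathSums

open Matrix

variable {X : Type*}

theorem pathLaw_nonneg {A : Matrix X X ℝ} (hA : ∀ x y, 0 ≤ A x y) {p : X → ℝ} (hp : ∀ x, 0 ≤ p x)
    {n : ℕ} (x : Fin (n + 1) → X) : 0 ≤ pathLaw A p n x :=
  mul_nonneg (hp _) (Finset.prod_nonneg fun _ _ => hA _ _)

variable [Fintype X]

theorem sum_pathLaw_zero (A : Matrix X X ℝ) (p : X → ℝ) : ∑ x, pathLaw A p 0 x = ∑ x, p x := by
  rw [← (Equiv.funUnique (Fin 1) X).symm.sum_comp]
  simp [pathLaw]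

theorem sum_pathLaw_succ (A : Matrix X X ℝ) (p : X → ℝ) (n : ℕ) :
    ∑ x, pathLaw A p (n + 1) x = ∑ x, pathLaw A (A *ᵥ p) n x := by
  rw [← (Fin.consEquiv fun _ : Fin (n + 2) => X).sum_comp, Fintype.sum_prod_type,
    Finset.sum_comm]
  refine Finset.sum_congr rfl fun x _ => ?_
  simp only [pathLaw, mulVec, dotProduct, Fin.consEquiv, Equiv.coe_fn_mk, Fin.cons_zero,
    Finset.sum_mul]
  refine Finset.sum_congr rfl fun y _ => ?_
  rw [Fin.prod_univ_succ]
  simp only [Fin.cons_succ, Fin.castSucc_zero, Fin.cons_zero, ← Fin.succ_castSucc]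
  ring

/-- A left eigenvector with entries in `[a, b]` controls the total mass of the path weights up to
the factors `a` and `b`, uniformly in the length of the paths. -/
theorem sum_pathLaw_bounds {A : Matrix X X ℝ} (hA : ∀ x y, 0 ≤ A x y) {u : X → ℝ} {l a b : ℝ}
    (huA : u ᵥ* A = l • u) (ha : ∀ x, a ≤ u x) (hb : ∀ x, u x ≤ b) (n : ℕ) (p : X → ℝ)
    (hp : ∀ x, 0 ≤ p x) :
    a * ∑ x, pathLaw A p n x ≤ l ^ n * (u ⬝ᵥ p) ∧ l ^ n * (u ⬝ᵥ p) ≤ b * ∑ x, pathLaw A p n x := by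
  induction n generalizing p with
  | zero =>
    rw [sum_pathLaw_zero, pow_zero, one_mul, Finset.mul_sum, Finset.mul_sum]
    exact ⟨Finset.sum_le_sum fun x _ => mul_le_mul_of_nonneg_right (ha x) (hp x),
      Finset.sum_le_sum fun x _ => mul_le_mul_of_nonneg_right (hb x) (hp x)⟩
  | succ n ih =>
    have h1 : u ⬝ᵥ (A *ᵥ p) = l * (u ⬝ᵥ p) := by
      rw [dotProduct_mulVec, huA, smul_dotProduct, smul_eq_mul]
    have h2 := ih (A *ᵥ p) fun x => Finset.sum_nonneg fun y _ => mul_nonneg (hA x y) (hp y)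
    rw [h1, ← mul_assoc, ← pow_succ] at h2
    rwa [sum_pathLaw_succ]

theorem sum_pathLaw_eq_one [DecidableEq X] {W : Matrix X X ℝ} (hW : W ∈ colStochastic ℝ X)
    {p : X → ℝ} (hp : p ∈ stdSimplex ℝ X) (n : ℕ) : ∑ x, pathLaw W p n x = 1 := by
  have h := sum_pathLaw_bounds (u := 1) (l := 1) (a := 1) (b := 1)
    (fun x y => nonneg_of_mem_colStochastic hW)
    (by rw [one_smul]; exact one_vecMul_of_mem_colStochastic hW) (fun _ => le_rfl)
    (fun _ => le_rfl) n p hp.1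
  have hp1 : (1 : X → ℝ) ⬝ᵥ p = 1 := by simpa [dotProduct] using hp.2
  rw [hp1] at h
  simp only [one_pow, one_mul] at h
  exact le_antisymm h.1 h.2

/-- The total mass of the tilted path weights is `exp (n φ(s))` up to constants that are uniform in
`n` and in `s` near `0`. -/
theorem sum_pathLaw_tilted_bounds [DecidableEq X] [Nonempty X] {W : Matrix X X ℝ}
    (hW : W ∈ colStochastic ℝ X) (hirr : W.IsIrreducible) (g : X → X → ℝ) {q : ℝ → X → ℝ}
    (hq : ∀ s x, 0 ≤ q s x) (hqc : ContinuousAt q 0) (hq0 : q 0 ≠ 0) :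
    ∃ c C : ℝ, 0 < c ∧ 0 < C ∧ ∀ᶠ s in 𝓝 0, ∀ n : ℕ,
      c * Real.exp (n * potential W g s) ≤ ∑ x, pathLaw (tilted W g s) (q s) n x ∧
      ∑ x, pathLaw (tilted W g s) (q s) n x ≤ C * Real.exp (n * potential W g s) := by
  obtain ⟨p, hp, hWp, hp1⟩ := exists_stationary hW hirr
  obtain ⟨l, u, hl, hu, hl0, hu0, hue, hle⟩ := exists_perron_branch hW hirr g hp hWp hp1
  have hu_near : ∀ᶠ s in 𝓝 0, ∀ x, u s x ∈ Set.Ioo (1 / 2 : ℝ) 2 := eventually_all.mpr fun x =>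
    ((continuous_apply x).continuousAt.comp hu.continuousAt).eventually_mem
      (Ioo_mem_nhds (by norm_num [hu0]) (by norm_num [hu0]))
  obtain ⟨x, hx⟩ := Function.ne_iff.mp hq0
  have hQ : 0 < u 0 ⬝ᵥ q 0 := Finset.sum_pos'
    (fun y _ => mul_nonneg (by simp [hu0]) (hq 0 y))
    ⟨x, Finset.mem_univ x, by simpa [hu0] using lt_of_le_of_ne (hq 0 x) (Ne.symm hx)⟩
  have hQc : ContinuousAt (fun s => u s ⬝ᵥ q s) 0 :=
    tendsto_finsetSum _ fun x _ => ((continuousAt_pi.mp hu.continuousAt x).mul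
      (continuousAt_pi.mp hqc x))
  have hQ_near := hQc.eventually_mem (Ioo_mem_nhds (half_lt_self hQ) (lt_two_mul_self hQ))
  refine ⟨(u 0 ⬝ᵥ q 0) / 2 / 2, 2 * (2 * (u 0 ⬝ᵥ q 0)), by positivity, by positivity, ?_⟩
  filter_upwards [hue, hle, hu_near, hQ_near,
    hl.continuousAt.eventually_const_lt (u := 0) (by simp [hl0])] with s hs hls hus hQs hl_pos n
  have hb := sum_pathLaw_bounds (A := tilted W g s)
    (fun x y => mul_nonneg (hirr.nonneg x y) (Real.exp_pos _).le) hs.2 (fun x => (hus x).1.le)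
    (fun x => (hus x).2.le) n (q s) (hq s)
  have hexp : Real.exp (n * potential W g s) = l s ^ n := by
    rw [potential, hls, Real.exp_nat_mul, Real.exp_log hl_pos]
  have hln : 0 < l s ^ n := pow_pos hl_pos n
  rw [hexp]
  have h1 := mul_lt_mul_of_pos_left hQs.1 hln
  have h2 := mul_lt_mul_of_pos_left hQs.2 hln
  constructor <;> linarith [hb.1, hb.2]

end PathSums

/-! ### The moderate-deviation scale -/

section ScaledLimit

theorem tendsto_rpow_neg_mul_const {t : ℝ} (ht : 0 < t) (σ : ℝ) :
    Tendsto (fun n : ℕ => σ * (n : ℝ) ^ (-t)) atTop (𝓝 0) := by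
  simpa using ((tendsto_rpow_neg_atTop ht).comp tendsto_natCast_atTop_atTop).const_mul σ

/-- If `Z n s = exp (n φ(s) + O(1))` uniformly near `s = 0`, then at the moderate-deviation scale
`s = σ n^{-t}` only the quadratic term of `φ` survives. -/
theorem tendsto_log_div_rpow {φ : ℝ → ℝ} (hφ0 : φ 0 = 0) (hφ : ContDiffAt ℝ 2 φ 0)
    {Z : ℕ → ℝ → ℝ} {c C : ℝ} (hc : 0 < c) (hC : 0 < C)
    (hZ : ∀ᶠ s in 𝓝 0, ∀ n : ℕ, c * Real.exp (n * φ s) ≤ Z n s ∧ Z n s ≤ C * Real.exp (n * φ s))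
    {t : ℝ} (ht : t ∈ Set.Ioo (0 : ℝ) (1 / 2)) (σ : ℝ) :
    (∀ᶠ n : ℕ in atTop, 0 < Z n (σ * (n : ℝ) ^ (-t))) ∧
    Tendsto (fun n : ℕ => (Real.log (Z n (σ * (n : ℝ) ^ (-t))) -
        σ * (n : ℝ) ^ (-t) * n * deriv φ 0) / (n : ℝ) ^ (1 - 2 * t)) atTop
      (𝓝 (σ ^ 2 * iteratedDeriv 2 φ 0 / 2)) := by
  have hs := tendsto_rpow_neg_mul_const ht.1 σ
  have hZs := hs.eventually hZ
  refine ⟨hZs.mono fun n hn => (mul_pos hc (Real.exp_pos _)).trans_le (hn n).1, ?_⟩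
  have ha : Tendsto (fun n : ℕ => (n : ℝ) ^ (1 - 2 * t)) atTop atTop :=
    (tendsto_rpow_atTop (by linarith [ht.2])).comp tendsto_natCast_atTop_atTop
  -- the contribution of `φ`
  have hmain : Tendsto (fun n : ℕ => (n * φ (σ * (n : ℝ) ^ (-t)) -
      σ * (n : ℝ) ^ (-t) * n * deriv φ 0) / (n : ℝ) ^ (1 - 2 * t)) atTop
      (𝓝 (σ ^ 2 * iteratedDeriv 2 φ 0 / 2)) := by
    have h1 := (isLittleO_sub_taylor_two hφ).comp_tendsto hs
    have h2 : (fun n : ℕ => (σ * (n : ℝ) ^ (-t)) ^ 2) =O[atTop]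
        fun n : ℕ => ((n : ℝ) ^ (2 * t))⁻¹ := by
      refine IsBigO.of_bound (σ ^ 2) (Eventually.of_forall fun n => ?_)
      rw [← Real.rpow_neg n.cast_nonneg, mul_pow, ← Real.rpow_natCast ((n : ℝ) ^ (-t)),
        ← Real.rpow_mul n.cast_nonneg, Real.norm_eq_abs, Real.norm_eq_abs, abs_mul,
        abs_of_nonneg (sq_nonneg σ)]
      apply le_of_eq
      congr 3
      push_cast
      ring
    have h3 := (h1.trans_isBigO h2).tendsto_div_nhds_zero
    have h4 := h3.add_const (σ ^ 2 * iteratedDeriv 2 φ 0 / 2)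
    rw [zero_add] at h4
    refine h4.congr' ?_
    filter_upwards [eventually_gt_atTop 0] with n hn
    have hn' : (0 : ℝ) < n := Nat.cast_pos.mpr hn
    have e1 : (n : ℝ) ^ (1 - 2 * t) = n * ((n : ℝ) ^ (2 * t))⁻¹ := by
      rw [Real.rpow_sub hn', Real.rpow_one, div_eq_mul_inv]
    have e2 : ((n : ℝ) ^ (-t)) ^ 2 = ((n : ℝ) ^ (2 * t))⁻¹ := by
      rw [← Real.rpow_natCast ((n : ℝ) ^ (-t)), ← Real.rpow_mul n.cast_nonneg,
        ← Real.rpow_neg n.cast_nonneg]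
      congr 1
      push_cast
      ring
    have hpos : 0 < ((n : ℝ) ^ (2 * t))⁻¹ := inv_pos.mpr (Real.rpow_pos_of_pos hn' _)
    simp only [Function.comp, hφ0, e1, mul_pow, e2]
    field_simp
    ring
  have hlim : ∀ K : ℝ, Tendsto (fun n : ℕ => Real.log K / (n : ℝ) ^ (1 - 2 * t) +
      (n * φ (σ * (n : ℝ) ^ (-t)) - σ * (n : ℝ) ^ (-t) * n * deriv φ 0) /
        (n : ℝ) ^ (1 - 2 * t)) atTop (𝓝 (σ ^ 2 * iteratedDeriv 2 φ 0 / 2)) := fun K => by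
    simpa using (tendsto_const_nhds.div_atTop ha).add hmain
  refine tendsto_of_tendsto_of_tendsto_of_le_of_le' (hlim c) (hlim C) ?_ ?_
  · filter_upwards [hZs] with n hn
    rw [← add_div]
    refine div_le_div_of_nonneg_right ?_ (Real.rpow_nonneg n.cast_nonneg _)
    have := Real.log_le_log (mul_pos hc (Real.exp_pos _)) (hn n).1
    rw [Real.log_mul hc.ne' (Real.exp_pos _).ne', Real.log_exp] at this
    linarith
  · filter_upwards [hZs] with n hn
    rw [← add_div]
    refine div_le_div_of_nonneg_right ?_ (Real.rpow_nonneg n.cast_nonneg _)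
    have := Real.log_le_log ((mul_pos hc (Real.exp_pos _)).trans_le (hn n).1) (hn n).2
    rw [Real.log_mul hC.ne' (Real.exp_pos _).ne', Real.log_exp] at this
    linarith

end ScaledLimit

/-! ### Deviations under a quadratic cumulant generating function -/

section QuadraticDeviations

variable {Ω : ℕ → Type*} [∀ n, Fintype (Ω n)] {μ Y : ∀ n, Ω n → ℝ} {a : ℕ → ℝ} {V : ℝ}

theorem eventually_exp_le_and_le_exp {Z : ℕ → ℝ} {L η : ℝ} (ha : Tendsto a atTop atTop)
    (hpos : ∀ᶠ n in atTop, 0 < Z n)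
    (hlim : Tendsto (fun n => Real.log (Z n) / a n) atTop (𝓝 L)) (hη : 0 < η) :
    ∀ᶠ n in atTop, Real.exp (a n * (L - η)) ≤ Z n ∧ Z n ≤ Real.exp (a n * (L + η)) := by
  filter_upwards [hpos, ha.eventually_gt_atTop 0,
    hlim.eventually_mem (Ioo_mem_nhds (sub_lt_self L hη) (lt_add_of_pos_right L hη))]
    with n hZ han h
  rw [← Real.le_log_iff_exp_le hZ, ← Real.log_le_iff_le_exp hZ, mul_comm, mul_comm (a n)]
  exact ⟨((lt_div_iff₀ han).mp h.1).le, ((div_lt_iff₀ han).mp h.2).le⟩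

/-- Chernoff's bound with the exponent `σ = δ / V`, which minimizes `σ² V / 2 - σ δ`. -/
theorem eventually_tail_le_exp (ha : Tendsto a atTop atTop) (hμ : ∀ n ω, 0 ≤ μ n ω) (hV : 0 < V)
    (hpos : ∀ σ : ℝ, ∀ᶠ n in atTop, 0 < ∑ ω, μ n ω * Real.exp (σ * (a n * Y n ω)))
    (hlim : ∀ σ : ℝ, Tendsto
      (fun n => Real.log (∑ ω, μ n ω * Real.exp (σ * (a n * Y n ω))) / a n) atTop
      (𝓝 (σ ^ 2 * V / 2)))
    {δ η : ℝ} (hδ : 0 ≤ δ) (hη : 0 < η) :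
    ∀ᶠ n in atTop, ∑ ω with δ ≤ Y n ω, μ n ω ≤ Real.exp (a n * (-(δ ^ 2 / (2 * V)) + η)) := by
  filter_upwards [eventually_exp_le_and_le_exp ha (hpos (δ / V)) (hlim (δ / V)) hη,
    ha.eventually_ge_atTop 0] with n hn han
  have hexp : Real.exp (a n * (-(δ ^ 2 / (2 * V)) + η)) =
      Real.exp (-(δ / V * (a n * δ))) * Real.exp (a n * ((δ / V) ^ 2 * V / 2 + η)) := by
    rw [← Real.exp_add]
    congr 1
    field_simp
    ring
  rw [hexp]
  refine le_trans ?_ (mul_le_mul_of_nonneg_left hn.2 (Real.exp_pos _).le)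
  rw [Finset.mul_sum, Finset.sum_filter]
  refine Finset.sum_le_sum fun ω _ => ?_
  split_ifs with h
  · rw [mul_left_comm, ← Real.exp_add]
    refine le_mul_of_one_le_right (hμ n ω) (Real.one_le_exp ?_)
    have := mul_le_mul_of_nonneg_left (mul_le_mul_of_nonneg_left h han) (div_nonneg hδ hV.le)
    linarith
  · exact mul_nonneg (Real.exp_pos _).le (mul_nonneg (hμ n ω) (Real.exp_pos _).le)

/-- Cramér's lower bound: under the weights tilted by `σ = (δ + w) / V`, the variable `Y` is
exponentially concentrated on the window `[δ, δ + 2 w]`, and there the tilting factor is at most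
`exp (σ a (δ + 2 w))`. -/
theorem eventually_exp_le_tail (ha : Tendsto a atTop atTop) (hμ : ∀ n ω, 0 ≤ μ n ω) (hV : 0 < V)
    (hpos : ∀ σ : ℝ, ∀ᶠ n in atTop, 0 < ∑ ω, μ n ω * Real.exp (σ * (a n * Y n ω)))
    (hlim : ∀ σ : ℝ, Tendsto
      (fun n => Real.log (∑ ω, μ n ω * Real.exp (σ * (a n * Y n ω))) / a n) atTop
      (𝓝 (σ ^ 2 * V / 2)))
    {δ η : ℝ} (hδ : 0 ≤ δ) (hη : 0 < η) :
    ∀ᶠ n in atTop, Real.exp (a n * (-(δ ^ 2 / (2 * V)) - η)) ≤ ∑ ω with δ ≤ Y n ω, μ n ω := by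
  obtain ⟨w, hw, hwη⟩ : ∃ w : ℝ, 0 < w ∧ (4 * δ * w + 13 / 4 * w ^ 2) / (2 * V) + w < η := by
    have hc : ContinuousAt (fun w : ℝ => (4 * δ * w + 13 / 4 * w ^ 2) / (2 * V) + w) 0 := by
      fun_prop
    have h1 : ∀ᶠ w in 𝓝[>] (0 : ℝ), (4 * δ * w + 13 / 4 * w ^ 2) / (2 * V) + w < η :=
      (hc.eventually_lt_const (u := η) (by simpa using hη)).filter_mono nhdsWithin_le_nhds
    obtain ⟨w, hw1, hw2⟩ := (h1.and self_mem_nhdsWithin).exists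
    exact ⟨w, hw2, hw1⟩
  set σ := (δ + w) / V with hσ
  set τ := w / V with hτ
  have hτ0 : 0 ≤ τ := by positivity
  have hσ0 : 0 ≤ σ := by positivity
  have hη' : 0 < w ^ 2 / (8 * V) := by positivity
  filter_upwards [eventually_exp_le_and_le_exp ha (hpos σ) (hlim σ) hη',
    eventually_exp_le_and_le_exp ha (hpos (σ - τ)) (hlim (σ - τ)) hη',
    eventually_exp_le_and_le_exp ha (hpos (σ + τ)) (hlim (σ + τ)) hη',
    ha.eventually_ge_atTop 0, ha.eventually_ge_atTop (Real.log 2 / w),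
    ha.eventually_ge_atTop (Real.log 4 / (w ^ 2 / (4 * V)))] with n h0 hm hp han haw haw'
  set Z := ∑ ω, μ n ω * Real.exp (σ * (a n * Y n ω))
  set F := ∑ ω with δ ≤ Y n ω, μ n ω with hF
  set E := Real.exp (a n * (σ ^ 2 * V / 2 - w ^ 2 / (8 * V))) with hE
  have hsplit : Z ≤ Real.exp (τ * (a n * δ)) * ∑ ω, μ n ω * Real.exp ((σ - τ) * (a n * Y n ω)) +
      Real.exp (-(τ * (a n * (δ + 2 * w)))) *
        ∑ ω, μ n ω * Real.exp ((σ + τ) * (a n * Y n ω)) +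
      Real.exp (σ * (a n * (δ + 2 * w))) * F := by
    rw [hF, Finset.mul_sum, Finset.mul_sum, Finset.mul_sum, Finset.sum_filter,
      ← Finset.sum_add_distrib, ← Finset.sum_add_distrib]
    refine Finset.sum_le_sum fun ω _ => ?_
    have n1 : 0 ≤ Real.exp (τ * (a n * δ)) * (μ n ω * Real.exp ((σ - τ) * (a n * Y n ω))) :=
      mul_nonneg (Real.exp_pos _).le (mul_nonneg (hμ n ω) (Real.exp_pos _).le)
    have n2 : 0 ≤ Real.exp (-(τ * (a n * (δ + 2 * w)))) *
        (μ n ω * Real.exp ((σ + τ) * (a n * Y n ω))) :=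
      mul_nonneg (Real.exp_pos _).le (mul_nonneg (hμ n ω) (Real.exp_pos _).le)
    have n3 : 0 ≤ Real.exp (σ * (a n * (δ + 2 * w))) * μ n ω :=
      mul_nonneg (Real.exp_pos _).le (hμ n ω)
    split_ifs with h
    · rcases le_or_gt (Y n ω) (δ + 2 * w) with h' | h'
      · have : μ n ω * Real.exp (σ * (a n * Y n ω)) ≤
            Real.exp (σ * (a n * (δ + 2 * w))) * μ n ω := by
          rw [mul_comm]
          exact mul_le_mul_of_nonneg_right (Real.exp_le_exp.mpr (mul_le_mul_of_nonneg_left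
            (mul_le_mul_of_nonneg_left h' han) hσ0)) (hμ n ω)
        linarith
      · have : μ n ω * Real.exp (σ * (a n * Y n ω)) ≤ Real.exp (-(τ * (a n * (δ + 2 * w)))) *
            (μ n ω * Real.exp ((σ + τ) * (a n * Y n ω))) := by
          rw [mul_left_comm _ (μ n ω), ← Real.exp_add]
          refine mul_le_mul_of_nonneg_left (Real.exp_le_exp.mpr ?_) (hμ n ω)
          have := mul_le_mul_of_nonneg_left (mul_le_mul_of_nonneg_left h'.le han) hτ0
          linarith
        linarith
    · have : μ n ω * Real.exp (σ * (a n * Y n ω)) ≤ Real.exp (τ * (a n * δ)) *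
          (μ n ω * Real.exp ((σ - τ) * (a n * Y n ω))) := by
        rw [mul_left_comm _ (μ n ω), ← Real.exp_add]
        refine mul_le_mul_of_nonneg_left (Real.exp_le_exp.mpr ?_) (hμ n ω)
        have := mul_le_mul_of_nonneg_left (mul_le_mul_of_nonneg_left (not_le.mp h).le han) hτ0
        linarith
      linarith
  -- each of the two terms outside the window is at most a quarter of the total
  have hquarter : Real.exp (a n * (-(w ^ 2 / (4 * V)))) ≤ 1 / 4 := by
    rw [div_le_iff₀ (by positivity)] at haw'
    rw [← Real.le_log_iff_exp_le (by norm_num), one_div, Real.log_inv]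
    linarith
  have hlow : Real.exp (τ * (a n * δ)) * ∑ ω, μ n ω * Real.exp ((σ - τ) * (a n * Y n ω)) ≤
      E / 4 := by
    have e : Real.exp (τ * (a n * δ)) * Real.exp (a n * ((σ - τ) ^ 2 * V / 2 + w ^ 2 / (8 * V))) =
        E * Real.exp (a n * (-(w ^ 2 / (4 * V)))) := by
      rw [hE, ← Real.exp_add, ← Real.exp_add, hσ, hτ]
      congr 1
      field_simp
      ring
    have h1 := mul_le_mul_of_nonneg_left hm.2 (Real.exp_pos (τ * (a n * δ))).le
    have h2 := mul_le_mul_of_nonneg_left hquarter (Real.exp_pos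
      (a n * (σ ^ 2 * V / 2 - w ^ 2 / (8 * V)))).le
    rw [e] at h1
    linarith
  have hhigh : Real.exp (-(τ * (a n * (δ + 2 * w)))) *
      ∑ ω, μ n ω * Real.exp ((σ + τ) * (a n * Y n ω)) ≤ E / 4 := by
    have e : Real.exp (-(τ * (a n * (δ + 2 * w)))) *
        Real.exp (a n * ((σ + τ) ^ 2 * V / 2 + w ^ 2 / (8 * V))) =
        E * Real.exp (a n * (-(w ^ 2 / (4 * V)))) := by
      rw [hE, ← Real.exp_add, ← Real.exp_add, hσ, hτ]
      congr 1
      field_simp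
      ring
    have h1 := mul_le_mul_of_nonneg_left hp.2 (Real.exp_pos (-(τ * (a n * (δ + 2 * w))))).le
    have h2 := mul_le_mul_of_nonneg_left hquarter (Real.exp_pos
      (a n * (σ ^ 2 * V / 2 - w ^ 2 / (8 * V)))).le
    rw [e] at h1
    linarith
  have hwin : E / 2 ≤ Real.exp (σ * (a n * (δ + 2 * w))) * F := by linarith [h0.1]
  have hhalf : Real.exp (a n * (-w)) ≤ 1 / 2 := by
    rw [div_le_iff₀ hw] at haw
    rw [← Real.le_log_iff_exp_le (by norm_num), one_div, Real.log_inv]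
    linarith
  have hfin : Real.exp (-(σ * (a n * (δ + 2 * w)))) * (E * Real.exp (a n * (-w))) ≤ F := by
    have h1 : E * Real.exp (a n * (-w)) ≤ Real.exp (σ * (a n * (δ + 2 * w))) * F := by
      have := mul_le_mul_of_nonneg_left hhalf (Real.exp_pos
        (a n * (σ ^ 2 * V / 2 - w ^ 2 / (8 * V)))).le
      linarith
    rw [Real.exp_neg, inv_mul_le_iff₀ (Real.exp_pos _)]
    exact h1
  refine le_trans ?_ hfin
  rw [hE, ← Real.exp_add, ← Real.exp_add, Real.exp_le_exp]
  have e : -(σ * (a n * (δ + 2 * w))) + (a n * (σ ^ 2 * V / 2 - w ^ 2 / (8 * V)) + a n * (-w)) =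
      a n * (-(δ ^ 2 / (2 * V)) - ((4 * δ * w + 13 / 4 * w ^ 2) / (2 * V) + w)) := by
    rw [hσ]
    field_simp
    ring
  rw [e]
  exact mul_le_mul_of_nonneg_left (by linarith) han

end QuadraticDeviations

/-! ### Error probabilities and likelihood-ratio tests -/

section Tests

variable {Ω : Type*} [Fintype Ω] {ε : ℝ} {P Q : Ω → ℝ}

theorem le_betaRandomized {c : ℝ} (hε : 0 ≤ ε)
    (h : ∀ T : Ω → ℝ, (∀ ω, T ω ∈ Set.Icc (0 : ℝ) 1) → ∑ ω, P ω * T ω ≤ ε →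
      c ≤ ∑ ω, Q ω * (1 - T ω)) : c ≤ betaRandomized ε P Q := by
  refine le_csInf ⟨_, 0, fun _ => by simp, by simpa using hε, rfl⟩ ?_
  rintro b ⟨T, hT, hP, rfl⟩
  exact h T hT hP

theorem betaDeterministic_le (hQ : ∀ ω, 0 ≤ Q ω) (hQ1 : ∑ ω, Q ω = 1) {S : Finset Ω}
    (hS : ∑ ω ∈ S, P ω ≤ ε) : betaDeterministic ε P Q ≤ 1 - ∑ ω ∈ S, Q ω := by
  refine csInf_le ⟨0, ?_⟩ ⟨S, hS, rfl⟩
  rintro b ⟨S', -, rfl⟩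
  rw [sub_nonneg, ← hQ1]
  exact Finset.sum_le_univ_sum_of_nonneg hQ

theorem betaRandomized_le_betaDeterministic (hε : 0 ≤ ε) (hQ : ∀ ω, 0 ≤ Q ω)
    (hQ1 : ∑ ω, Q ω = 1) : betaRandomized ε P Q ≤ betaDeterministic ε P Q := by
  classical
  refine le_csInf ⟨_, ∅, by simpa using hε, rfl⟩ ?_
  rintro b ⟨S, hS, rfl⟩
  refine csInf_le ⟨0, ?_⟩ ⟨fun ω => if ω ∈ S then 1 else 0, fun ω => ?_, ?_, ?_⟩
  · rintro b ⟨T, hT, -, rfl⟩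
    exact Finset.sum_nonneg fun ω _ => mul_nonneg (hQ ω) (sub_nonneg.mpr (hT ω).2)
  · dsimp only
    split_ifs <;> simp
  · simpa using hS
  · simp [mul_sub, hQ1]

variable {M N : Ω → ℝ}

/-- Achieved by the likelihood-ratio test `T = 1` on `{M > e^b N}`, where `N ≤ e^{-b} M`. -/
theorem betaDeterministic_exp_neg_le (hM : ∀ ω, 0 ≤ M ω) (hM1 : ∑ ω, M ω = 1) (b : ℝ) :
    betaDeterministic (Real.exp (-b)) N M ≤ ∑ ω with M ω ≤ Real.exp b * N ω, M ω := by
  have hsplit := Finset.sum_filter_add_sum_filter_not Finset.univ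
    (fun ω => M ω ≤ Real.exp b * N ω) M
  refine (betaDeterministic_le hM hM1
    (S := Finset.univ.filter fun ω => ¬ M ω ≤ Real.exp b * N ω) ?_).trans (by linarith)
  have h1 : ∑ ω with ¬ M ω ≤ Real.exp b * N ω, N ω ≤
      ∑ ω with ¬ M ω ≤ Real.exp b * N ω, Real.exp (-b) * M ω := by
    refine Finset.sum_le_sum fun ω hω => ?_
    rw [Finset.mem_filter, not_le] at hω
    rw [Real.exp_neg, ← div_eq_inv_mul, le_div_iff₀' (Real.exp_pos b)]
    exact hω.2.le
  refine h1.trans ?_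
  rw [← Finset.mul_sum]
  refine mul_le_of_le_one_right (Real.exp_pos _).le ?_
  rw [← hM1]
  exact Finset.sum_le_univ_sum_of_nonneg hM

/-- On `{M ≤ e^b N}` a test with `E_N[T] ≤ ε` captures at most the mass `e^b ε` of `M`. -/
theorem sub_le_betaRandomized (hε : 0 ≤ ε) (hM : ∀ ω, 0 ≤ M ω) (hN : ∀ ω, 0 ≤ N ω) (b : ℝ) :
    ∑ ω with M ω ≤ Real.exp b * N ω, M ω - Real.exp b * ε ≤ betaRandomized ε N M := by
  refine le_betaRandomized hε fun T hT hNT => ?_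
  have h1 : ∑ ω with M ω ≤ Real.exp b * N ω, M ω * T ω ≤ Real.exp b * ε := by
    refine le_trans ?_ (mul_le_mul_of_nonneg_left hNT (Real.exp_pos b).le)
    rw [Finset.mul_sum, Finset.sum_filter]
    refine Finset.sum_le_sum fun ω _ => ?_
    split_ifs with h
    · rw [← mul_assoc]
      exact mul_le_mul_of_nonneg_right h (hT ω).1
    · exact mul_nonneg (Real.exp_pos b).le (mul_nonneg (hN ω) (hT ω).1)
  have h2 : ∑ ω with M ω ≤ Real.exp b * N ω, M ω * (1 - T ω) ≤ ∑ ω, M ω * (1 - T ω) :=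
    Finset.sum_le_univ_sum_of_nonneg fun ω => mul_nonneg (hM ω) (sub_nonneg.mpr (hT ω).2)
  simp only [mul_sub, mul_one, Finset.sum_sub_distrib] at h2 ⊢
  linarith

/-- Achieved by the likelihood-ratio test `T = 1` on `{M ≤ e^b N}`; its complement has `N`-mass at
most `e^{-b}`. -/
theorem betaDeterministic_le_exp_neg (hM : ∀ ω, 0 ≤ M ω) (hM1 : ∑ ω, M ω = 1)
    (hN : ∀ ω, 0 ≤ N ω) (hN1 : ∑ ω, N ω = 1) {b : ℝ}
    (h : ∑ ω with M ω ≤ Real.exp b * N ω, M ω ≤ ε) :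
    betaDeterministic ε M N ≤ Real.exp (-b) := by
  refine (betaDeterministic_le hN hN1 h).trans ?_
  have hsplit := Finset.sum_filter_add_sum_filter_not Finset.univ
    (fun ω => M ω ≤ Real.exp b * N ω) N
  have h1 : ∑ ω with ¬ M ω ≤ Real.exp b * N ω, N ω ≤
      ∑ ω with ¬ M ω ≤ Real.exp b * N ω, Real.exp (-b) * M ω := by
    refine Finset.sum_le_sum fun ω hω => ?_
    rw [Finset.mem_filter, not_le] at hω
    rw [Real.exp_neg, ← div_eq_inv_mul, le_div_iff₀' (Real.exp_pos b)]
    exact hω.2.le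
  have h2 : ∑ ω with ¬ M ω ≤ Real.exp b * N ω, Real.exp (-b) * M ω ≤ Real.exp (-b) := by
    rw [← Finset.mul_sum]
    refine mul_le_of_le_one_right (Real.exp_pos _).le ?_
    rw [← hM1]
    exact Finset.sum_le_univ_sum_of_nonneg hM
  linarith

/-- On `{M ≤ e^b N}` a test with `E_M[T] ≤ ε` misses all but `ε` of the mass of `M`, and `N` is at
least `e^{-b} M` there. -/
theorem exp_neg_mul_sub_le_betaRandomized (hε : 0 ≤ ε) (hM : ∀ ω, 0 ≤ M ω) (hN : ∀ ω, 0 ≤ N ω)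
    (b : ℝ) :
    Real.exp (-b) * (∑ ω with M ω ≤ Real.exp b * N ω, M ω - ε) ≤ betaRandomized ε M N := by
  refine le_betaRandomized hε fun T hT hMT => ?_
  rw [Real.exp_neg, inv_mul_le_iff₀ (Real.exp_pos b)]
  have h1 : ∑ ω with M ω ≤ Real.exp b * N ω, M ω * T ω ≤ ε :=
    (Finset.sum_le_univ_sum_of_nonneg fun ω => mul_nonneg (hM ω) (hT ω).1).trans hMT
  have h2 : ∑ ω with M ω ≤ Real.exp b * N ω, M ω * (1 - T ω) ≤
      Real.exp b * ∑ ω, N ω * (1 - T ω) := by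
    rw [Finset.mul_sum, Finset.sum_filter]
    refine Finset.sum_le_sum fun ω _ => ?_
    have hT' := sub_nonneg.mpr (hT ω).2
    split_ifs with h
    · rw [← mul_assoc]
      exact mul_le_mul_of_nonneg_right h hT'
    · exact mul_nonneg (Real.exp_pos b).le (mul_nonneg (hN ω) hT')
  simp only [mul_sub, mul_one, Finset.sum_sub_distrib] at h2 ⊢
  linarith

end Tests

/-! ### Moderate deviations of the log-likelihood ratio -/

section LikelihoodRatio

open Matrix

variable {X : Type*}

theorem pathLaw_pos_iff {A : Matrix X X ℝ} (hA : ∀ x y, 0 ≤ A x y) {p : X → ℝ}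
    (hp : ∀ x, 0 ≤ p x) {n : ℕ} (x : Fin (n + 1) → X) :
    0 < pathLaw A p n x ↔ 0 < p (x 0) ∧ ∀ i : Fin n, 0 < A (x i.succ) (x i.castSucc) := by
  constructor
  · intro h
    have h1 : p (x 0) ≠ 0 := left_ne_zero_of_mul h.ne'
    have h2 := Finset.prod_ne_zero_iff.mp (right_ne_zero_of_mul h.ne')
    exact ⟨lt_of_le_of_ne (hp _) h1.symm,
      fun i => lt_of_le_of_ne (hA _ _) (h2 i (Finset.mem_univ i)).symm⟩
  · rintro ⟨h1, h2⟩
    exact mul_pos h1 (Finset.prod_pos fun i _ => h2 i)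

variable {W₀ W₁ : Matrix X X ℝ} {P₀ P₁ : X → ℝ}

/-- The initial weights `P₀^{1-s} P₁^s` on the common support of `P₀` and `P₁`. -/
noncomputable def tiltedInitial (P₀ P₁ : X → ℝ) (s : ℝ) (x : X) : ℝ :=
  if 0 < P₁ x then P₀ x * Real.exp (s * (Real.log (P₁ x) - Real.log (P₀ x))) else 0

/-- Tilting the path law by the log-likelihood ratio gives the path weights of the tilted
matrix. -/
theorem pathLaw_mul_exp_eq (hnn₀ : ∀ x y, 0 ≤ W₀ x y) (hnn₁ : ∀ x y, 0 ≤ W₁ x y)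
    (hsupp : ∀ x y, 0 < W₀ x y ↔ 0 < W₁ x y) (hP₀ : ∀ x, 0 ≤ P₀ x) (hP₁ : ∀ x, 0 ≤ P₁ x)
    (n : ℕ) (s : ℝ) (x : Fin (n + 1) → X) :
    (if 0 < pathLaw W₁ P₁ n x then pathLaw W₀ P₀ n x else 0) *
        Real.exp (s * (Real.log (pathLaw W₁ P₁ n x) - Real.log (pathLaw W₀ P₀ n x))) =
      pathLaw (tilted W₀ (fun x y => Real.log (W₁ x y / W₀ x y)) s)
        (tiltedInitial P₀ P₁ s) n x := by
  by_cases hW : ∀ i : Fin n, 0 < W₀ (x i.succ) (x i.castSucc)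
  swap
  · obtain ⟨i, hi⟩ := not_forall.mp hW
    have hi0 : W₀ (x i.succ) (x i.castSucc) = 0 := le_antisymm (not_lt.mp hi) (hnn₀ _ _)
    rw [if_neg fun h => hi ((hsupp _ _).mpr (((pathLaw_pos_iff hnn₁ hP₁ x).mp h).2 i)), zero_mul,
      pathLaw, Finset.prod_eq_zero (Finset.mem_univ i) (by simp [tilted, hi0]), mul_zero]
  have hW' : ∀ i : Fin n, 0 < W₁ (x i.succ) (x i.castSucc) := fun i => (hsupp _ _).mp (hW i)
  by_cases h1 : 0 < P₁ (x 0)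
  swap
  · rw [if_neg fun h => h1 ((pathLaw_pos_iff hnn₁ hP₁ x).mp h).1]
    simp [pathLaw, tiltedInitial, h1]
  rw [if_pos ((pathLaw_pos_iff hnn₁ hP₁ x).mpr ⟨h1, hW'⟩)]
  rcases (hP₀ (x 0)).eq_or_lt with h0 | h0
  · simp [pathLaw, tiltedInitial, ← h0]
  have hlog : Real.log (pathLaw W₁ P₁ n x) - Real.log (pathLaw W₀ P₀ n x) =
      (Real.log (P₁ (x 0)) - Real.log (P₀ (x 0))) +
        ∑ i : Fin n, Real.log (W₁ (x i.succ) (x i.castSucc) / W₀ (x i.succ) (x i.castSucc)) := by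
    rw [pathLaw, pathLaw, Real.log_mul h1.ne' (Finset.prod_pos fun i _ => hW' i).ne',
      Real.log_mul h0.ne' (Finset.prod_pos fun i _ => hW i).ne',
      Real.log_prod fun i _ => (hW' i).ne', Real.log_prod fun i _ => (hW i).ne']
    simp only [fun i => Real.log_div (hW' i).ne' (hW i).ne', Finset.sum_sub_distrib]
    ring
  rw [hlog, mul_add, Real.exp_add, Finset.mul_sum, Real.exp_sum]
  simp only [pathLaw, tilted, of_apply, tiltedInitial, if_pos h1, Finset.prod_mul_distrib]
  ring

/-- Moderate deviations of the log-likelihood ratio: under the chain with matrix `W₀`, the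
likelihood ratio of the two path laws stays below `exp (n D - n^{1-t} δ)` with probability
`exp (-n^{1-2t} (δ² / (2 V) + o(1)))`. -/
theorem eventually_likelihoodRatio_bounds [Fintype X] [DecidableEq X] [Nonempty X]
    (hW₀ : W₀ ∈ colStochastic ℝ X) (hirr₀ : W₀.IsIrreducible) (hnn₁ : ∀ x y, 0 ≤ W₁ x y)
    (hsupp : ∀ x y, 0 < W₀ x y ↔ 0 < W₁ x y) (hP₀ : ∀ x, 0 ≤ P₀ x) (hP₁ : ∀ x, 0 ≤ P₁ x)
    (hP : ∃ x, 0 < P₀ x ∧ 0 < P₁ x) {V D : ℝ} (hφ0 : testPotential W₀ W₁ 0 = 0)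
    (hφ : ContDiffAt ℝ 2 (testPotential W₀ W₁) 0)
    (hVeq : iteratedDeriv 2 (testPotential W₀ W₁) 0 = V) (hV : 0 < V)
    (hD : D = -deriv (testPotential W₀ W₁) 0)
    {t : ℝ} (ht : t ∈ Set.Ioo (0 : ℝ) (1 / 2)) {δ η : ℝ} (hδ : 0 ≤ δ) (hη : 0 < η) :
    ∀ᶠ n : ℕ in atTop,
      Real.exp ((n : ℝ) ^ (1 - 2 * t) * (-(δ ^ 2 / (2 * V)) - η)) ≤
        ∑ x with pathLaw W₀ P₀ n x ≤
          Real.exp (n * D - (n : ℝ) ^ (1 - t) * δ) * pathLaw W₁ P₁ n x, pathLaw W₀ P₀ n x ∧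
      ∑ x with pathLaw W₀ P₀ n x ≤
          Real.exp (n * D - (n : ℝ) ^ (1 - t) * δ) * pathLaw W₁ P₁ n x, pathLaw W₀ P₀ n x ≤
        Real.exp ((n : ℝ) ^ (1 - 2 * t) * (-(δ ^ 2 / (2 * V)) + η)) := by
  set g : X → X → ℝ := fun x y => Real.log (W₁ x y / W₀ x y) with hg
  let μ : ∀ n : ℕ, (Fin (n + 1) → X) → ℝ := fun n x =>
    if 0 < pathLaw W₁ P₁ n x then pathLaw W₀ P₀ n x else 0
  let Y : ∀ n : ℕ, (Fin (n + 1) → X) → ℝ := fun n x =>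
    (Real.log (pathLaw W₁ P₁ n x) - Real.log (pathLaw W₀ P₀ n x) + n * D) / (n : ℝ) ^ (1 - t)
  let Z : ℕ → ℝ → ℝ := fun n s => ∑ x, pathLaw (tilted W₀ g s) (tiltedInitial P₀ P₁ s) n x
  have ha : Tendsto (fun n : ℕ => (n : ℝ) ^ (1 - 2 * t)) atTop atTop :=
    (tendsto_rpow_atTop (by linarith [ht.2])).comp tendsto_natCast_atTop_atTop
  have hM : ∀ n x, 0 ≤ pathLaw W₀ P₀ n x := fun n x => pathLaw_nonneg hirr₀.nonneg hP₀ x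
  have hN : ∀ n x, 0 ≤ pathLaw W₁ P₁ n x := fun n x => pathLaw_nonneg hnn₁ hP₁ x
  have hμ : ∀ n x, 0 ≤ μ n x := fun n x => by
    simp only [μ]
    split_ifs
    exacts [hM n x, le_rfl]
  obtain ⟨c, C, hc, hC, hZ⟩ := sum_pathLaw_tilted_bounds hW₀ hirr₀ g (q := tiltedInitial P₀ P₁)
    (fun s x => by
      rw [tiltedInitial]
      split_ifs
      exacts [mul_nonneg (hP₀ x) (Real.exp_pos _).le, le_rfl])
    (continuousAt_pi.mpr fun x => by
      simp only [tiltedInitial]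
      split_ifs <;> fun_prop)
    (by
      obtain ⟨x, hx0, hx1⟩ := hP
      refine Function.ne_iff.mpr ⟨x, ?_⟩
      simpa [tiltedInitial, hx1] using hx0.ne')
  have hsum : ∀ σ : ℝ, ∀ n : ℕ, 0 < n →
      ∑ x, μ n x * Real.exp (σ * ((n : ℝ) ^ (1 - 2 * t) * Y n x)) =
        Real.exp (σ * (n : ℝ) ^ (-t) * n * D) * Z n (σ * (n : ℝ) ^ (-t)) := by
    intro σ n hn
    have hn' : (0 : ℝ) < n := Nat.cast_pos.mpr hn
    simp only [Z, Finset.mul_sum]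
    refine Finset.sum_congr rfl fun x _ => ?_
    rw [← pathLaw_mul_exp_eq hirr₀.nonneg hnn₁ hsupp hP₀ hP₁,
      mul_left_comm (Real.exp (σ * (n : ℝ) ^ (-t) * n * D)), ← Real.exp_add]
    have e : (n : ℝ) ^ (1 - 2 * t) = (n : ℝ) ^ (-t) * (n : ℝ) ^ (1 - t) := by
      rw [← Real.rpow_add hn']
      congr 1
      ring
    have hpos : 0 < (n : ℝ) ^ (1 - t) := Real.rpow_pos_of_pos hn' _
    congr 2
    simp only [Y]
    rw [e]
    field_simp
    ring
  have hlim := fun σ => tendsto_log_div_rpow hφ0 hφ hc hC hZ ht σ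
  have hpos : ∀ σ : ℝ, ∀ᶠ n : ℕ in atTop,
      0 < ∑ x, μ n x * Real.exp (σ * ((n : ℝ) ^ (1 - 2 * t) * Y n x)) := by
    intro σ
    filter_upwards [(hlim σ).1, eventually_gt_atTop 0] with n hn hn0
    rw [hsum σ n hn0]
    exact mul_pos (Real.exp_pos _) hn
  have hlim' : ∀ σ : ℝ, Tendsto (fun n : ℕ =>
      Real.log (∑ x, μ n x * Real.exp (σ * ((n : ℝ) ^ (1 - 2 * t) * Y n x))) /
        (n : ℝ) ^ (1 - 2 * t)) atTop (𝓝 (σ ^ 2 * V / 2)) := by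
    intro σ
    rw [← hVeq]
    refine (hlim σ).2.congr' ?_
    filter_upwards [(hlim σ).1, eventually_gt_atTop 0] with n hn hn0
    rw [hsum σ n hn0, Real.log_mul (Real.exp_pos _).ne' hn.ne', Real.log_exp, hD]
    congr 1
    ring
  filter_upwards [eventually_exp_le_tail ha hμ hV hpos hlim' hδ hη,
    eventually_tail_le_exp ha hμ hV hpos hlim' hδ hη, eventually_gt_atTop 0] with n h1 h2 hn0
  have hna : 0 < (n : ℝ) ^ (1 - t) := Real.rpow_pos_of_pos (Nat.cast_pos.mpr hn0) _
  have hF : ∑ x with pathLaw W₀ P₀ n x ≤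
      Real.exp (n * D - (n : ℝ) ^ (1 - t) * δ) * pathLaw W₁ P₁ n x, pathLaw W₀ P₀ n x =
      ∑ x with δ ≤ Y n x, μ n x := by
    rw [Finset.sum_filter, Finset.sum_filter]
    refine Finset.sum_congr rfl fun x _ => ?_
    rcases (hM n x).eq_or_lt with h0 | h0
    · simp [μ, ← h0]
    rcases (hN n x).eq_or_lt with h1 | h1
    · simp [μ, ← h1, h0.not_ge]
    have hiff : pathLaw W₀ P₀ n x ≤
        Real.exp (n * D - (n : ℝ) ^ (1 - t) * δ) * pathLaw W₁ P₁ n x ↔ δ ≤ Y n x := by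
      rw [← Real.log_le_log_iff h0 (mul_pos (Real.exp_pos _) h1),
        Real.log_mul (Real.exp_pos _).ne' h1.ne', Real.log_exp, le_div_iff₀ hna]
      constructor <;> intro h <;> linarith
    simp only [hiff, μ, if_pos h1]
  rw [hF]
  exact ⟨h1, h2⟩

end LikelihoodRatio

/-! ### Asymptotic expansions of the error probabilities -/

section Asymptotics

theorem tendsto_neg_inv_mul_log {β a : ℕ → ℝ} {L : ℝ} (ha : Tendsto a atTop atTop)
    (hlow : ∀ η : ℝ, 0 < η → ∀ᶠ n in atTop, Real.exp (a n * (-L - η)) ≤ β n)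
    (hupp : ∀ η : ℝ, 0 < η → ∀ᶠ n in atTop, β n ≤ Real.exp (a n * (-L + η))) :
    Tendsto (fun n => -(1 / a n) * Real.log (β n)) atTop (𝓝 L) := by
  rw [Metric.tendsto_nhds]
  intro η hη
  filter_upwards [hlow (η / 2) (half_pos hη), hupp (η / 2) (half_pos hη),
    ha.eventually_gt_atTop 0] with n h1 h2 han
  have hβ : 0 < β n := (Real.exp_pos _).trans_le h1
  rw [← Real.le_log_iff_exp_le hβ] at h1
  rw [← Real.log_le_iff_le_exp hβ] at h2
  have h1' : -L - η / 2 ≤ Real.log (β n) / a n := by rwa [le_div_iff₀' han]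
  have h2' : Real.log (β n) / a n ≤ -L + η / 2 := by rwa [div_le_iff₀' han]
  rw [Real.dist_eq, show -(1 / a n) * Real.log (β n) = -(Real.log (β n) / a n) by ring, abs_lt]
  constructor <;> linarith

theorem tendsto_natCast_rpow_atTop {y : ℝ} (hy : 0 < y) :
    Tendsto (fun n : ℕ => (n : ℝ) ^ y) atTop atTop :=
  (tendsto_rpow_atTop hy).comp tendsto_natCast_atTop_atTop

theorem natCast_rpow_one_sub {n : ℕ} (hn : 0 < n) (t : ℝ) :
    (n : ℝ) ^ (1 - t) = (n : ℝ) ^ (1 - 2 * t) * (n : ℝ) ^ t := by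
  rw [← Real.rpow_add (Nat.cast_pos.mpr hn)]
  congr 1
  ring

variable {Ω : ℕ → Type*} [∀ n, Fintype (Ω n)] {M N : ∀ n, Ω n → ℝ} {V D t : ℝ}

/-- The first expansion, for any error probability between those of the best randomized and the
best deterministic test. The upper bound is the likelihood-ratio test at the threshold `δ`. For the
lower bound the threshold is moved to `δ + κ`: the error term then becomes `exp (-κ n^{1-t})`, which
is negligible at the scale `n^{1-2t}`. -/
theorem tendsto_log_beta (hM : ∀ n ω, 0 ≤ M n ω) (hM1 : ∀ n, ∑ ω, M n ω = 1)
    (hN : ∀ n ω, 0 ≤ N n ω) (ht : t ∈ Set.Ioo (0 : ℝ) (1 / 2))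
    (hMD : ∀ δ η : ℝ, 0 ≤ δ → 0 < η → ∀ᶠ n : ℕ in atTop,
      Real.exp ((n : ℝ) ^ (1 - 2 * t) * (-(δ ^ 2 / (2 * V)) - η)) ≤
        ∑ ω with M n ω ≤ Real.exp (n * D - (n : ℝ) ^ (1 - t) * δ) * N n ω, M n ω ∧
      ∑ ω with M n ω ≤ Real.exp (n * D - (n : ℝ) ^ (1 - t) * δ) * N n ω, M n ω ≤
        Real.exp ((n : ℝ) ^ (1 - 2 * t) * (-(δ ^ 2 / (2 * V)) + η)))
    {δ : ℝ} (hδ : 0 ≤ δ) {β : ℕ → ℝ}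
    (hβ : ∀ n : ℕ, betaRandomized (Real.exp (-(n * D) + (n : ℝ) ^ (1 - t) * δ)) (N n) (M n) ≤ β n)
    (hβ' : ∀ n : ℕ,
      β n ≤ betaDeterministic (Real.exp (-(n * D) + (n : ℝ) ^ (1 - t) * δ)) (N n) (M n)) :
    Tendsto (fun n : ℕ => -(1 / (n : ℝ) ^ (1 - 2 * t)) * Real.log (β n)) atTop
      (𝓝 (δ ^ 2 / (2 * V))) := by
  have ha : Tendsto (fun n : ℕ => (n : ℝ) ^ (1 - 2 * t)) atTop atTop :=
    tendsto_natCast_rpow_atTop (by linarith [ht.2])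
  refine tendsto_neg_inv_mul_log ha (fun η hη => ?_) (fun η hη => ?_)
  · obtain ⟨κ, hκ, hκη⟩ : ∃ κ : ℝ, 0 < κ ∧ (δ + κ) ^ 2 / (2 * V) < δ ^ 2 / (2 * V) + η / 3 := by
      have hc : ContinuousAt (fun κ : ℝ => (δ + κ) ^ 2 / (2 * V)) 0 := by fun_prop
      have h1 : ∀ᶠ κ in 𝓝[>] (0 : ℝ), (δ + κ) ^ 2 / (2 * V) < δ ^ 2 / (2 * V) + η / 3 :=
        (hc.eventually_lt_const (u := δ ^ 2 / (2 * V) + η / 3)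
          (by simp only [add_zero]; linarith)).filter_mono nhdsWithin_le_nhds
      obtain ⟨κ, hκ1, hκ2⟩ := (h1.and self_mem_nhdsWithin).exists
      exact ⟨κ, hκ2, hκ1⟩
    filter_upwards [hMD (δ + κ) (η / 3) (by positivity) (by positivity),
      (tendsto_natCast_rpow_atTop ht.1).eventually_ge_atTop ((δ ^ 2 / (2 * V) + η) / κ),
      ha.eventually_ge_atTop (Real.log 2 / (η / 3)), ha.eventually_ge_atTop 0,
      eventually_gt_atTop 0] with n hn hnt hna hn0 hnpos
    refine le_trans ?_ (hβ n)
    refine le_trans ?_ (sub_le_betaRandomized (Real.exp_pos _).le (hM n) (hN n)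
      (n * D - (n : ℝ) ^ (1 - t) * (δ + κ)))
    rw [← Real.exp_add, show n * D - (n : ℝ) ^ (1 - t) * (δ + κ) +
      (-(n * D) + (n : ℝ) ^ (1 - t) * δ) = -((n : ℝ) ^ (1 - t) * κ) by ring, le_sub_iff_add_le]
    set a := (n : ℝ) ^ (1 - 2 * t)
    set E := Real.exp (a * (-(δ ^ 2 / (2 * V)) - η)) with hE
    have h1 : Real.exp (-((n : ℝ) ^ (1 - t) * κ)) ≤ E := by
      rw [hE, Real.exp_le_exp, natCast_rpow_one_sub hnpos]
      rw [div_le_iff₀ hκ] at hnt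
      have := mul_le_mul_of_nonneg_left hnt hn0
      linarith
    have h2 : 2 * E ≤ Real.exp (a * (-((δ + κ) ^ 2 / (2 * V)) - η / 3)) := by
      rw [div_le_iff₀ (by positivity)] at hna
      nth_rw 1 [← Real.exp_log (zero_lt_two' ℝ)]
      rw [hE, ← Real.exp_add, Real.exp_le_exp]
      have := mul_le_mul_of_nonneg_left hκη.le hn0
      linarith
    linarith [hn.1]
  · filter_upwards [hMD δ η hδ hη] with n hn
    refine (hβ' n).trans (le_trans ?_ hn.2)
    rw [show -(n * D) + (n : ℝ) ^ (1 - t) * δ = -(n * D - (n : ℝ) ^ (1 - t) * δ) by ring]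
    exact betaDeterministic_exp_neg_le (hM n) (hM1 n) _

/-- The second expansion, for any error probability between those of the best randomized and the
best deterministic test. The event `{M ≤ e^b N}` has `M`-probability below the level `ε` for
thresholds `δ` above `√(2 V r)`, where it serves as a test, and above `2 ε` for thresholds below
`√(2 V r)`, where it yields the converse bound. -/
theorem isLittleO_log_beta (hM : ∀ n ω, 0 ≤ M n ω) (hM1 : ∀ n, ∑ ω, M n ω = 1)
    (hN : ∀ n ω, 0 ≤ N n ω) (hN1 : ∀ n, ∑ ω, N n ω = 1) (hV : 0 < V)
    (ht : t ∈ Set.Ioo (0 : ℝ) (1 / 2))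
    (hMD : ∀ δ η : ℝ, 0 ≤ δ → 0 < η → ∀ᶠ n : ℕ in atTop,
      Real.exp ((n : ℝ) ^ (1 - 2 * t) * (-(δ ^ 2 / (2 * V)) - η)) ≤
        ∑ ω with M n ω ≤ Real.exp (n * D - (n : ℝ) ^ (1 - t) * δ) * N n ω, M n ω ∧
      ∑ ω with M n ω ≤ Real.exp (n * D - (n : ℝ) ^ (1 - t) * δ) * N n ω, M n ω ≤
        Real.exp ((n : ℝ) ^ (1 - 2 * t) * (-(δ ^ 2 / (2 * V)) + η)))
    {r : ℝ} (hr : 0 < r) {β : ℕ → ℝ}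
    (hβ : ∀ n : ℕ, betaRandomized (Real.exp (-((n : ℝ) ^ (1 - 2 * t) * r))) (M n) (N n) ≤ β n)
    (hβ' : ∀ n : ℕ,
      β n ≤ betaDeterministic (Real.exp (-((n : ℝ) ^ (1 - 2 * t) * r))) (M n) (N n)) :
    (fun n : ℕ => -Real.log (β n) - (D * n - √(2 * V * r) * (n : ℝ) ^ (1 - t)))
      =o[atTop] fun n : ℕ => (n : ℝ) ^ (1 - t) := by
  have ha : Tendsto (fun n : ℕ => (n : ℝ) ^ (1 - 2 * t)) atTop atTop :=
    tendsto_natCast_rpow_atTop (by linarith [ht.2])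
  rw [isLittleO_iff]
  intro c hc
  have hVr : 0 < 2 * V * r := by positivity
  set q := √(2 * V * r) with hq
  have hq0 : 0 < q := Real.sqrt_pos.mpr hVr
  have hq2 : q ^ 2 = 2 * V * r := Real.sq_sqrt hVr.le
  have hsq : ∀ x : ℝ, x ^ 2 / (2 * V) - r = (x ^ 2 - q ^ 2) / (2 * V) := fun x => by
    rw [hq2]
    field_simp
  have hη₁ : 0 < (q + c) ^ 2 / (2 * V) - r := by
    rw [hsq]
    exact div_pos (sub_pos.mpr (by gcongr; linarith)) (by positivity)
  -- `c` may exceed `q`, while the deviation estimate needs a nonnegative threshold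
  set δ₂ := max (q - c / 2) 0 with hδ₂
  have hδ₂0 : 0 ≤ δ₂ := le_max_right _ _
  have hδ₂q : δ₂ < q := max_lt (by linarith) hq0
  have hη₂ : 0 < r - δ₂ ^ 2 / (2 * V) := by
    rw [← neg_sub, hsq, neg_pos]
    exact div_neg_of_neg_of_pos (sub_neg.mpr (by gcongr)) (by positivity)
  filter_upwards [hMD (q + c) _ (by positivity) hη₁, hMD δ₂ _ hδ₂0 (half_pos hη₂),
    (tendsto_natCast_rpow_atTop ht.1).eventually_ge_atTop (r / (c / 2)),
    ha.eventually_ge_atTop (Real.log 2 / ((r - δ₂ ^ 2 / (2 * V)) / 2)), ha.eventually_ge_atTop 0,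
    eventually_gt_atTop 0] with n h1 h2 hnt hna hn0 hnpos
  have hs := natCast_rpow_one_sub hnpos t
  have hs0 : 0 ≤ (n : ℝ) ^ (1 - t) := Real.rpow_nonneg n.cast_nonneg _
  set a := (n : ℝ) ^ (1 - 2 * t)
  set b := (n : ℝ) ^ (1 - t)
  have hupp : β n ≤ Real.exp (-(n * D - b * (q + c))) := by
    refine (hβ' n).trans (betaDeterministic_le_exp_neg (hM n) (hM1 n) (hN n) (hN1 n) ?_)
    refine h1.2.trans (Real.exp_le_exp.mpr (le_of_eq ?_))
    ring
  have hlow : Real.exp (-(n * D - b * δ₂) - a * r) ≤ β n := by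
    refine le_trans ?_ ((exp_neg_mul_sub_le_betaRandomized (Real.exp_pos _).le (hM n) (hN n)
      (n * D - b * δ₂)).trans (hβ n))
    rw [sub_eq_add_neg, Real.exp_add]
    refine mul_le_mul_of_nonneg_left ?_ (Real.exp_pos _).le
    have h3 : 2 * Real.exp (-(a * r)) ≤
        Real.exp (a * (-(δ₂ ^ 2 / (2 * V)) - (r - δ₂ ^ 2 / (2 * V)) / 2)) := by
      rw [div_le_iff₀ (half_pos hη₂)] at hna
      nth_rw 1 [← Real.exp_log (zero_lt_two' ℝ)]
      rw [← Real.exp_add, Real.exp_le_exp]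
      linarith
    linarith [h2.1]
  have hβ0 : 0 < β n := (Real.exp_pos _).trans_le hlow
  rw [← Real.le_log_iff_exp_le hβ0] at hlow
  rw [← Real.log_le_iff_le_exp hβ0] at hupp
  have har : a * r ≤ c / 2 * b := by
    rw [div_le_iff₀ (half_pos hc)] at hnt
    rw [hs]
    have := mul_le_mul_of_nonneg_left hnt hn0
    linarith
  have hbδ : b * (q - c / 2) ≤ b * δ₂ := mul_le_mul_of_nonneg_left (le_max_left _ _) hs0
  rw [Real.norm_eq_abs, Real.norm_eq_abs, abs_of_nonneg hs0, abs_le]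
  constructor <;> linarith

end Asymptotics

end MarkovTesting

theorem mainTheorem6 {X : Type*} [Fintype X] [DecidableEq X]
    (W₀ W₁ : Matrix X X ℝ)
    (hW₀ : MarkovTesting.IsErgodicTransition W₀)
    (hW₁ : MarkovTesting.IsErgodicTransition W₁)
    (hsupp : ∀ x y, 0 < W₀ x y ↔ 0 < W₁ x y)
    (hne : W₀ ≠ W₁)
    (P₀ P₁ : X → ℝ) (hP₀ : P₀ ∈ stdSimplex ℝ X) (hP₁ : P₁ ∈ stdSimplex ℝ X)
    (hP : ∃ x, 0 < P₀ x ∧ 0 < P₁ x)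
    (t : ℝ) (ht : t ∈ Set.Ioo (0 : ℝ) (1 / 2)) :
    -- the quantities in the two expansions are well defined, and the second derivative is positive
    (DifferentiableAt ℝ (MarkovTesting.renyiPotential W₀ W₁) 1 ∧
      ContDiffAt ℝ 2 (MarkovTesting.testPotential W₀ W₁) 0 ∧
      0 < iteratedDeriv 2 (MarkovTesting.testPotential W₀ W₁) 0) ∧
    -- first expansion, for randomized and for deterministic tests
    (∀ δ : ℝ, 0 ≤ δ →
      Tendsto (fun n : ℕ => -(1 / (n : ℝ) ^ (1 - 2 * t)) * Real.log
          (MarkovTesting.betaRandomized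
            (Real.exp (-(n * MarkovTesting.relEntropy W₀ W₁) + (n : ℝ) ^ (1 - t) * δ))
            (MarkovTesting.pathLaw W₁ P₁ n) (MarkovTesting.pathLaw W₀ P₀ n)))
        atTop (𝓝 (δ ^ 2 / (2 * iteratedDeriv 2 (MarkovTesting.testPotential W₀ W₁) 0))) ∧
      Tendsto (fun n : ℕ => -(1 / (n : ℝ) ^ (1 - 2 * t)) * Real.log
          (MarkovTesting.betaDeterministic
            (Real.exp (-(n * MarkovTesting.relEntropy W₀ W₁) + (n : ℝ) ^ (1 - t) * δ))
            (MarkovTesting.pathLaw W₁ P₁ n) (MarkovTesting.pathLaw W₀ P₀ n)))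
        atTop (𝓝 (δ ^ 2 / (2 * iteratedDeriv 2 (MarkovTesting.testPotential W₀ W₁) 0)))) ∧
    -- second expansion, for randomized and for deterministic tests
    (∀ r : ℝ, 0 < r →
      (fun n : ℕ => -Real.log
          (MarkovTesting.betaRandomized (Real.exp (-((n : ℝ) ^ (1 - 2 * t) * r)))
            (MarkovTesting.pathLaw W₀ P₀ n) (MarkovTesting.pathLaw W₁ P₁ n)) -
          (MarkovTesting.relEntropy W₀ W₁ * n -
            √(2 * iteratedDeriv 2 (MarkovTesting.testPotential W₀ W₁) 0 * r) *
              (n : ℝ) ^ (1 - t)))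
        =o[atTop] (fun n : ℕ => (n : ℝ) ^ (1 - t)) ∧
      (fun n : ℕ => -Real.log
          (MarkovTesting.betaDeterministic (Real.exp (-((n : ℝ) ^ (1 - 2 * t) * r)))
            (MarkovTesting.pathLaw W₀ P₀ n) (MarkovTesting.pathLaw W₁ P₁ n)) -
          (MarkovTesting.relEntropy W₀ W₁ * n -
            √(2 * iteratedDeriv 2 (MarkovTesting.testPotential W₀ W₁) 0 * r) *
              (n : ℝ) ^ (1 - t)))
        =o[atTop] (fun n : ℕ => (n : ℝ) ^ (1 - t))) := by
  obtain ⟨x₀, hx₀⟩ := hP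
  have : Nonempty X := ⟨x₀⟩
  have hnn₁ : ∀ x y, 0 ≤ W₁ x y := hW₁.irreducible.nonneg
  obtain ⟨hφ0, hφ, hV⟩ := MarkovTesting.testPotential_properties hW₀.stochastic hW₀.irreducible
    hW₁.stochastic hW₁.irreducible hsupp hne
  obtain ⟨hdiff, hD⟩ := MarkovTesting.renyiPotential_differentiableAt_and_relEntropy
    hW₀.irreducible.nonneg hnn₁ hsupp (hφ.differentiableAt (by norm_num))
  have hM : ∀ n x, 0 ≤ MarkovTesting.pathLaw W₀ P₀ n x := fun n x =>
    MarkovTesting.pathLaw_nonneg hW₀.irreducible.nonneg hP₀.1 x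
  have hN : ∀ n x, 0 ≤ MarkovTesting.pathLaw W₁ P₁ n x := fun n x =>
    MarkovTesting.pathLaw_nonneg hnn₁ hP₁.1 x
  have hM1 := MarkovTesting.sum_pathLaw_eq_one hW₀.stochastic hP₀
  have hN1 := MarkovTesting.sum_pathLaw_eq_one hW₁.stochastic hP₁
  have hMD := fun (δ η : ℝ) (hδ : 0 ≤ δ) (hη : 0 < η) =>
    MarkovTesting.eventually_likelihoodRatio_bounds hW₀.stochastic hW₀.irreducible hnn₁ hsupp
      hP₀.1 hP₁.1 ⟨x₀, hx₀⟩ hφ0 hφ rfl hV hD ht hδ hη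
  refine ⟨⟨hdiff, hφ, hV⟩, fun δ hδ => ?_, fun r hr => ?_⟩
  · have hle := fun n : ℕ => MarkovTesting.betaRandomized_le_betaDeterministic
      (ε := Real.exp (-(n * MarkovTesting.relEntropy W₀ W₁) + (n : ℝ) ^ (1 - t) * δ))
      (P := MarkovTesting.pathLaw W₁ P₁ n) (Real.exp_pos _).le (hM n) (hM1 n)
    exact ⟨MarkovTesting.tendsto_log_beta hM hM1 hN ht hMD hδ (fun _ => le_rfl) hle,
      MarkovTesting.tendsto_log_beta hM hM1 hN ht hMD hδ hle fun _ => le_rfl⟩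
  · have hle := fun n : ℕ => MarkovTesting.betaRandomized_le_betaDeterministic
      (ε := Real.exp (-((n : ℝ) ^ (1 - 2 * t) * r)))
      (P := MarkovTesting.pathLaw W₀ P₀ n) (Real.exp_pos _).le (hN n) (hN1 n)
    exact ⟨MarkovTesting.isLittleO_log_beta hM hM1 hN hN1 hV ht hMD hr (fun _ => le_rfl) hle,
      MarkovTesting.isLittleO_log_beta hM hM1 hN hN1 hV ht hMD hr hle fun _ => le_rfl⟩
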